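/- A Manin triple over a field $\Bbbk$ is a triple $(\mathfrak g,\mathfrak h,\mathfrak k)$, where $\mathfrak g$ is a Lie algebra over $\Bbbk$ with a nondegenerate invariant symmetric bilinear form $\kappa$, and $\mathfrak h,\mathfrak k\subset\mathfrak g$ are Lie subalgebras that are maximal isotropic subspaces, are perfectly paired by $\kappa$, and satisfy $\mathfrak g=\mathfrak h\oplus\mathfrak k$; we identify $\mathfrak k$ with $\mathfrak h^*$ and $\mathfrak h$ with $\mathfrak k^*$ by $\kappa$. Work in one of two settings: (a) real or complex Lie groups, with functions that are smooth (holomorphic in the complex case) on open sets, and smooth (holomorphic) homomorphisms; (b) affine algebraic groups over an algebraically closed field of characteristic $0$, with regular functions and morphisms of algebraic groups. Let $G$ be a group with Lie algebra $\mathfrak g$ and $H\subset G$ a connected subgroup with Lie algebra $\mathfrak h$ (in (a) possibly only immersed, in (b) closed). For a function $f$ on $H$ and $x$ in its domain let $\delta_xf,\delta'_xf\in\mathfrak k=\mathfrak h^*$ be the differentials of $f$ at $x$ in the trivializations by left and by right invariant vector fields, i.e. the differentials at $y=1$ of $y\mapsto f(xy)$ and of $y\mapsto f(yx)$. The Poisson–Lie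 bracket of the Manin triple on $H$ is $$\{f,g\}(x)=\kappa(\delta'_xf,\mathrm{Ad}_x(\delta_xg))-\kappa(\delta'_xg,\mathrm{Ad}_x(\delta_xf)).$$ Let also $$\{f,g\}^{\mathrm{left}}(x)=\kappa(\delta_xf,\mathrm{Ad}_x(\delta_xg))-\kappa(\delta_xg,\mathrm{Ad}_x(\delta_xf)).$$ **Lemma.** Let $(\mathfrak g_i,\mathfrak h_i,\mathfrak k_i)$, $i=1,2$, be Manin triples with forms $\kappa_i$, and let $H_i\subset G_i$ be as above, with $H_i$ connected. Let $\varphi:\mathfrak g_1\to\mathfrak g_2$ be a morphism of Lie algebras with $\varphi(\mathfrak h_1)\subset\mathfrak h_2$, $\varphi(\mathfrak k_1)\subset\mathfrak k_2$ and $\kappa_2(\varphi(u),\varphi(v))=\kappa_1(u,v)$ for all $u,v\in\mathfrak g_1$. Assume that the transpose $\psi:\mathfrak h_2\to\mathfrak h_1$ of $\varphi|_{\mathfrak k_1}:\mathfrak k_1\to\mathfrak k_2$, given by $\kappa_1(\psi(w),u)=\kappa_2(w,\varphi(u))$ for $w\in\mathfrak h_2$, $u\in\mathfrak k_1$, is a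 morphism of Lie algebras, and let $\Psi:H_2\to H_1$ be a homomorphism of groups with differential $\psi$. Then $\Psi$ is a morphism of Poisson groups: for all functions $f,g$ on $H_1$ (in (a): defined on an open set) and all $x\in H_2$ such that $f,g$ are defined at $\Psi(x)$, $$\{f\circ\Psi,g\circ\Psi\}(x)=\{f,g\}(\Psi(x)).$$ The same identity holds for the bracket $\{\cdot,\cdot\}^{\mathrm{left}}$. -/

import Mathlib

open scoped Manifold ContDiff Coalgebra
open WithConv

noncomputable section

/-! ### Manin triples -/

/-- A Manin triple `(L, h, k)` over a field `K`: a nondegenerate invariant symmetric bilinear form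
on the Lie algebra `L` and two maximal isotropic Lie subalgebras `h`, `k` which are perfectly
paired by the form and satisfy `L = h ⊕ k`. -/
structure ManinTriple (K L : Type*) [Field K] [LieRing L] [LieAlgebra K L] where
  form : LinearMap.BilinForm K L
  symm : form.IsSymm
  nondegenerate : form.Nondegenerate
  invariant : form.lieInvariant L
  h : LieSubalgebra K L
  k : LieSubalgebra K L
  h_maximal_isotropic :
    Maximal (fun W : Submodule K L => ∀ x ∈ W, ∀ y ∈ W, form x y = 0) h.toSubmodule
  k_maximal_isotropic :
    Maximal (fun W : Submodule K L => ∀ x ∈ W, ∀ y ∈ W, form x y = 0) k.toSubmodule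
  isCompl : IsCompl h.toSubmodule k.toSubmodule
  perfect : (form.domRestrict₁₂ k.toSubmodule h.toSubmodule).IsPerfPair

namespace ManinTriple

variable {K L L' : Type*} [Field K] [LieRing L] [LieAlgebra K L] [LieRing L'] [LieAlgebra K L']

/-- The identification of `h*` with `k`: the element `u = T.sharp a` of `k` is the one with
`form u w = a w` for all `w` in `h`. -/
def sharp (T : ManinTriple K L) : Module.Dual K T.h ≃ₗ[K] T.k :=
  haveI := T.perfect
  ((T.form.domRestrict₁₂ T.k.toSubmodule T.h.toSubmodule).toPerfPair).symm

theorem form_sharp (T : ManinTriple K L) (a : Module.Dual K T.h) (w : T.h) :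
    T.form (T.sharp a : L) (w : L) = a w := by
  have := T.perfect
  exact LinearMap.congr_fun ((T.form.domRestrict₁₂ T.k.toSubmodule
    T.h.toSubmodule).apply_symm_toPerfPair_self a) w

/-- The value `κ(a', A b) - κ(b', A a)`, for covectors `a, a', b, b'` in `h* = k`. -/
def bracketValue (T : ManinTriple K L) (A : L →ₗ[K] L) (a a' b b' : Module.Dual K T.h) : K :=
  T.form (T.sharp a' : L) (A (T.sharp b : L)) - T.form (T.sharp b' : L) (A (T.sharp a : L))

/-- A Lie algebra morphism that preserves the two subalgebras and the forms. -/
structure IsMorphism (T : ManinTriple K L) (T' : ManinTriple K L') (φ : L →ₗ⁅K⁆ L') : Prop where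
  map_h : ∀ w ∈ T.h, φ w ∈ T'.h
  map_k : ∀ u ∈ T.k, φ u ∈ T'.k
  map_form : ∀ u v : L, T'.form (φ u) (φ v) = T.form u v

/-- `ψ : h' → h` is the transpose of `φ : k → k'`, where `h = k*` and `h' = k'*` through the
forms. -/
def IsTranspose (T : ManinTriple K L) (T' : ManinTriple K L') (φ : L →ₗ⁅K⁆ L')
    (ψ : T'.h →ₗ⁅K⁆ T.h) : Prop :=
  ∀ w : T'.h, ∀ u ∈ T.k, T.form (ψ w : L) u = T'.form (w : L') (φ u)

end ManinTriple

/-! ### Real and complex Lie groups -/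

instance minSmoothness_three_leInfty {𝕜 : Type*} [RCLike 𝕜] :
    ENat.LEInfty (minSmoothness 𝕜 3) := by
  rw [minSmoothness_of_isRCLikeNormedField]
  infer_instance

namespace LieSetting

variable {𝕜 : Type*} [RCLike 𝕜]
  {E F : Type*} [NormedAddCommGroup E] [NormedSpace 𝕜 E] [CompleteSpace E]
  [NormedAddCommGroup F] [NormedSpace 𝕜 F] [CompleteSpace F]
  {G : Type*} [TopologicalSpace G] [ChartedSpace E G] [Group G] [LieGroup 𝓘(𝕜, E) ∞ G]
  {H : Type*} [TopologicalSpace H] [ChartedSpace F H] [Group H] [LieGroup 𝓘(𝕜, F) ∞ H]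

/-- The adjoint action of `x` on the Lie algebra: the differential at `1` of `y ↦ x y x⁻¹`. -/
def Ad (𝕜 : Type*) [RCLike 𝕜] {E : Type*} [NormedAddCommGroup E] [NormedSpace 𝕜 E]
    {G : Type*} [TopologicalSpace G] [ChartedSpace E G] [Group G] (x : G) :
    GroupLieAlgebra 𝓘(𝕜, E) G →ₗ[𝕜] GroupLieAlgebra 𝓘(𝕜, E) G :=
  (mfderiv 𝓘(𝕜, E) 𝓘(𝕜, E) (fun y : G => x * y * x⁻¹) 1).toLinearMap

/-- The differential of `f` at `x` in the trivialization of the cotangent bundle by left invariant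
vector fields, that is, the differential at `1` of `y ↦ f (x y)`. -/
def leftDiff (𝕜 : Type*) [RCLike 𝕜] {F : Type*} [NormedAddCommGroup F] [NormedSpace 𝕜 F]
    {H : Type*} [TopologicalSpace H] [ChartedSpace F H] [Group H] (f : H → 𝕜) (x : H) :
    GroupLieAlgebra 𝓘(𝕜, F) H →ₗ[𝕜] 𝕜 :=
  (mfderiv 𝓘(𝕜, F) 𝓘(𝕜, 𝕜) (fun y : H => f (x * y)) 1).toLinearMap

/-- The same with right invariant vector fields: the differential at `1` of `y ↦ f (y x)`. -/
def rightDiff (𝕜 : Type*) [RCLike 𝕜] {F : Type*} [NormedAddCommGroup F] [NormedSpace 𝕜 F]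
    {H : Type*} [TopologicalSpace H] [ChartedSpace F H] [Group H] (f : H → 𝕜) (x : H) :
    GroupLieAlgebra 𝓘(𝕜, F) H →ₗ[𝕜] 𝕜 :=
  (mfderiv 𝓘(𝕜, F) 𝓘(𝕜, 𝕜) (fun y : H => f (y * x)) 1).toLinearMap

/-- `H` as a (possibly only immersed) Lie subgroup of `G` with Lie algebra `T.h`: the inclusion is
a smooth injective homomorphism, and its differential at `1` identifies the Lie algebra of `H`
with `T.h`. -/
structure Subgroup (T : ManinTriple 𝕜 (GroupLieAlgebra 𝓘(𝕜, E) G)) (F : Type*)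
    [NormedAddCommGroup F] [NormedSpace 𝕜 F]
    (H : Type*) [TopologicalSpace H] [ChartedSpace F H] [Group H] where
  incl : H →* G
  contMDiff_incl : ContMDiff 𝓘(𝕜, F) 𝓘(𝕜, E) ∞ incl
  injective_incl : Function.Injective incl
  lieEquiv : GroupLieAlgebra 𝓘(𝕜, F) H ≃ₗ[𝕜] T.h
  lieEquiv_apply : ∀ w : GroupLieAlgebra 𝓘(𝕜, F) H,
    (lieEquiv w : GroupLieAlgebra 𝓘(𝕜, E) G) = mfderiv 𝓘(𝕜, F) 𝓘(𝕜, E) incl 1 w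

namespace Subgroup

variable {T : ManinTriple 𝕜 (GroupLieAlgebra 𝓘(𝕜, E) G)}

/-- `{f, g}(x) = κ(δ_x f, Ad_x δ_x g) - κ(δ_x g, Ad_x δ_x f)`, where all differentials are
trivialized by left invariant vector fields. -/
def leftBracket (S : Subgroup T F H) (f g : H → 𝕜) (x : H) : 𝕜 :=
  T.bracketValue (Ad 𝕜 (S.incl x))
    (leftDiff 𝕜 f x ∘ₗ S.lieEquiv.symm.toLinearMap) (leftDiff 𝕜 f x ∘ₗ S.lieEquiv.symm.toLinearMap)
    (leftDiff 𝕜 g x ∘ₗ S.lieEquiv.symm.toLinearMap) (leftDiff 𝕜 g x ∘ₗ S.lieEquiv.symm.toLinearMap)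

/-- The Poisson-Lie bracket of the Manin triple:
`{f, g}(x) = κ(δ'_x f, Ad_x δ_x g) - κ(δ'_x g, Ad_x δ_x f)`, where `δ` is the differential in the
left and `δ'` the differential in the right trivialization. -/
def poissonBracket (S : Subgroup T F H) (f g : H → 𝕜) (x : H) : 𝕜 :=
  T.bracketValue (Ad 𝕜 (S.incl x))
    (leftDiff 𝕜 f x ∘ₗ S.lieEquiv.symm.toLinearMap) (rightDiff 𝕜 f x ∘ₗ S.lieEquiv.symm.toLinearMap)
    (leftDiff 𝕜 g x ∘ₗ S.lieEquiv.symm.toLinearMap) (rightDiff 𝕜 g x ∘ₗ S.lieEquiv.symm.toLinearMap)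

end Subgroup

end LieSetting

/-! ### Affine algebraic groups

An affine algebraic group over an algebraically closed field `k` of characteristic zero is given by
its coordinate ring `A`, a finitely generated commutative Hopf algebra. Its group of points is
`WithConv (A →ₐ[k] k)`, a group under convolution `(x * y) f = ∑ x(f₁) y(f₂)`. Points and tangent
vectors at the unit are both elements of the convolution algebra `WithConv (A →ₗ[k] k)`. -/

namespace AlgSetting

variable {k : Type*} [Field k] {A B : Type*} [CommRing A] [HopfAlgebra k A]
  [CommRing B] [HopfAlgebra k B]

/-- A point of the group as an element of the convolution algebra. -/
def pt (x : WithConv (A →ₐ[k] k)) : WithConv (A →ₗ[k] k) := toConv x.ofConv.toLinearMap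

theorem pt_apply (x : WithConv (A →ₐ[k] k)) (a : A) : pt x a = x a := rfl

theorem pt_mul (x y : WithConv (A →ₐ[k] k)) : pt (x * y) = pt x * pt y := rfl

theorem pt_one : pt (1 : WithConv (A →ₐ[k] k)) = 1 := rfl

/-- The commutator bracket of the convolution algebra. -/
instance : LieRing (WithConv (A →ₗ[k] k)) := LieRing.ofAssociativeRing

theorem conv_apply_mul (D E : WithConv (A →ₗ[k] k)) (a b : A) :
    (D * E) (a * b) = ∑ i ∈ (ℛ k a).index, ∑ j ∈ (ℛ k b).index,
      D ((ℛ k a).left i * (ℛ k b).left j) * E ((ℛ k a).right i * (ℛ k b).right j) := by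
  rw [((ℛ k a).mul (ℛ k b)).convMul_apply]
  simp [Finset.sum_product]

theorem conv_mul_conv (u u' v v' : WithConv (A →ₗ[k] k)) (a b : A) :
    (u * u') a * (v * v') b = ∑ i ∈ (ℛ k a).index, ∑ j ∈ (ℛ k b).index,
      (u ((ℛ k a).left i) * v ((ℛ k b).left j)) *
        (u' ((ℛ k a).right i) * v' ((ℛ k b).right j)) := by
  rw [(ℛ k a).convMul_apply, (ℛ k b).convMul_apply, Finset.sum_mul_sum]
  refine Finset.sum_congr rfl fun i _ => Finset.sum_congr rfl fun j _ => ?_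
  ring

theorem one_conv_apply (a : A) :
    (1 : WithConv (A →ₗ[k] k)) a = Coalgebra.counit (R := k) a := by simp

theorem conv_derivations_apply_mul {D E : WithConv (A →ₗ[k] k)}
    (hD : ∀ a b : A, D (a * b) =
      Coalgebra.counit (R := k) a * D b + D a * Coalgebra.counit (R := k) b)
    (hE : ∀ a b : A, E (a * b) =
      Coalgebra.counit (R := k) a * E b + E a * Coalgebra.counit (R := k) b) (a b : A) :
    (D * E) (a * b) = Coalgebra.counit (R := k) a * (D * E) b + E a * D b + D a * E b +
      (D * E) a * Coalgebra.counit (R := k) b := by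
  have e1 := conv_mul_conv 1 1 D E a b
  have e2 := conv_mul_conv 1 E D 1 a b
  have e3 := conv_mul_conv D 1 1 E a b
  have e4 := conv_mul_conv D E 1 1 a b
  simp only [mul_one, one_mul, one_conv_apply] at e1 e2 e3 e4
  rw [conv_apply_mul, e1, e2, e3, e4]
  simp only [← Finset.sum_add_distrib, hD, hE]
  refine Finset.sum_congr rfl fun i _ => Finset.sum_congr rfl fun j _ => ?_
  ring

theorem conj_derivation_apply_mul {D : WithConv (A →ₗ[k] k)}
    (hD : ∀ a b : A, D (a * b) =
      Coalgebra.counit (R := k) a * D b + D a * Coalgebra.counit (R := k) b)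
    (x : WithConv (A →ₐ[k] k)) (a b : A) :
    (pt x * D * pt x⁻¹) (a * b) = Coalgebra.counit (R := k) a * (pt x * D * pt x⁻¹) b +
      (pt x * D * pt x⁻¹) a * Coalgebra.counit (R := k) b := by
  have hx : pt x * pt x⁻¹ = 1 := by rw [← pt_mul, mul_inv_cancel, pt_one]
  have hm : ∀ (y : WithConv (A →ₐ[k] k)) (c d : A), pt y (c * d) = pt y c * pt y d :=
    fun y c d => map_mul y.ofConv c d
  have h1 : ∀ c d : A, (pt x * D) (c * d) = pt x c * (pt x * D) d + (pt x * D) c * pt x d := by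
    intro c d
    have e1 := conv_mul_conv (pt x) 1 (pt x) D c d
    have e2 := conv_mul_conv (pt x) D (pt x) 1 c d
    simp only [mul_one, one_conv_apply] at e1 e2
    rw [conv_apply_mul, e1, e2]
    simp only [← Finset.sum_add_distrib, hD, hm]
    refine Finset.sum_congr rfl fun i _ => Finset.sum_congr rfl fun j _ => ?_
    ring
  have e1 := conv_mul_conv (pt x) (pt x⁻¹) (pt x * D) (pt x⁻¹) a b
  have e2 := conv_mul_conv (pt x * D) (pt x⁻¹) (pt x) (pt x⁻¹) a b
  simp only [hx, one_conv_apply] at e1 e2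
  rw [conv_apply_mul, e1, e2]
  simp only [← Finset.sum_add_distrib, h1, hm]
  refine Finset.sum_congr rfl fun i _ => Finset.sum_congr rfl fun j _ => ?_
  ring

/-- The Lie algebra of the group: the `k`-derivations of `A` at the counit, with the commutator
bracket of the convolution algebra (the bracket of left invariant derivations). -/
def lieAlgebra (k A : Type*) [Field k] [CommRing A] [HopfAlgebra k A] :
    LieSubalgebra k (WithConv (A →ₗ[k] k)) where
  carrier := {D | ∀ a b : A, D (a * b) =
    Coalgebra.counit (R := k) a * D b + D a * Coalgebra.counit (R := k) b}
  zero_mem' := by intro a b; simp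
  add_mem' := by
    intro D E hD hE a b
    have h1 := hD a b
    have h2 := hE a b
    simp only [ofConv_add, LinearMap.add_apply] at h1 h2 ⊢
    rw [h1, h2]; ring
  smul_mem' := by
    intro c D hD a b
    have h1 := hD a b
    simp only [ofConv_smul, LinearMap.smul_apply, smul_eq_mul] at h1 ⊢
    rw [h1]; ring
  lie_mem' := by
    intro D E hD hE a b
    have h1 := conv_derivations_apply_mul hD hE a b
    have h2 := conv_derivations_apply_mul hE hD a b
    have h3 : ∀ c : A, ⁅D, E⁆ c = (D * E) c - (E * D) c := fun c => rfl
    rw [h3, h3, h3, h1, h2]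
    ring

/-- The adjoint action `D ↦ x D x⁻¹`, i.e. the derivation `f ↦ D (y ↦ f (x y x⁻¹))`. -/
def Ad (x : WithConv (A →ₐ[k] k)) : lieAlgebra k A →ₗ[k] lieAlgebra k A where
  toFun D := ⟨pt x * D * pt x⁻¹, conj_derivation_apply_mul D.2 x⟩
  map_add' D E := by ext1; simp [mul_add, add_mul]
  map_smul' c D := by
    ext1
    change pt x * (c • (D : WithConv (A →ₗ[k] k))) * pt x⁻¹ =
      c • (pt x * (D : WithConv (A →ₗ[k] k)) * pt x⁻¹)
    rw [mul_smul_comm, smul_mul_assoc]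

/-- The differential of `f` at `x` in the trivialization of the cotangent bundle by left invariant
vector fields: `D ↦ D (y ↦ f (x y))`. -/
def leftDiff (f : A) (x : WithConv (A →ₐ[k] k)) : lieAlgebra k A →ₗ[k] k where
  toFun D := (pt x * (D : WithConv (A →ₗ[k] k))) f
  map_add' D E := by
    change (pt x * ((D : WithConv (A →ₗ[k] k)) + E)) f = _
    rw [mul_add]; rfl
  map_smul' c D := by
    change (pt x * (c • (D : WithConv (A →ₗ[k] k)))) f = _
    rw [mul_smul_comm]; rfl

/-- The same with right invariant vector fields: `D ↦ D (y ↦ f (y x))`. -/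
def rightDiff (f : A) (x : WithConv (A →ₐ[k] k)) : lieAlgebra k A →ₗ[k] k where
  toFun D := ((D : WithConv (A →ₗ[k] k)) * pt x) f
  map_add' D E := by
    change (((D : WithConv (A →ₗ[k] k)) + E) * pt x) f = _
    rw [add_mul]; rfl
  map_smul' c D := by
    change ((c • (D : WithConv (A →ₗ[k] k))) * pt x) f = _
    rw [smul_mul_assoc]; rfl

/-- The differential `D ↦ D ∘ p` of the group homomorphism with comorphism `p : A → B`. -/
def differential (p : A →ₐc[k] B) : lieAlgebra k B →ₗ[k] lieAlgebra k A where
  toFun D := ⟨toConv ((D : WithConv (B →ₗ[k] k)).ofConv ∘ₗ (p : A →ₐ[k] B).toLinearMap), by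
    intro a b
    have h1 := D.2 (p a) (p b)
    simpa using h1⟩
  map_add' D E := by ext1; rfl
  map_smul' c D := by ext1; rfl

/-- The group homomorphism on points, `x ↦ x ∘ p`, with comorphism `p : A → B`. -/
def onPoints (p : A →ₐc[k] B) (x : WithConv (B →ₐ[k] k)) : WithConv (A →ₐ[k] k) :=
  toConv (x.ofConv.comp (p : A →ₐ[k] B))

/-- The group `H` with coordinate ring `B` as a closed subgroup, with Lie algebra `T.h`, of the
group `G` with coordinate ring `A`: the restriction of functions `A → B` is onto, and the
differential of the inclusion identifies the Lie algebra of `H` with `T.h`. -/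
structure Subgroup (T : ManinTriple k (lieAlgebra k A)) (B : Type*) [CommRing B]
    [HopfAlgebra k B] where
  res : A →ₐc[k] B
  surjective_res : Function.Surjective res
  lieEquiv : lieAlgebra k B ≃ₗ[k] T.h
  lieEquiv_apply : ∀ D : lieAlgebra k B, (lieEquiv D : lieAlgebra k A) = differential res D

namespace Subgroup

variable {T : ManinTriple k (lieAlgebra k A)}

/-- `{f, g}(x) = κ(δ_x f, Ad_x δ_x g) - κ(δ_x g, Ad_x δ_x f)`, where all differentials are
trivialized by left invariant vector fields. -/
def leftBracket (S : Subgroup T B) (f g : B) (x : WithConv (B →ₐ[k] k)) : k :=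
  T.bracketValue (Ad (onPoints S.res x))
    (leftDiff f x ∘ₗ S.lieEquiv.symm.toLinearMap) (leftDiff f x ∘ₗ S.lieEquiv.symm.toLinearMap)
    (leftDiff g x ∘ₗ S.lieEquiv.symm.toLinearMap) (leftDiff g x ∘ₗ S.lieEquiv.symm.toLinearMap)

/-- The Poisson-Lie bracket of the Manin triple:
`{f, g}(x) = κ(δ'_x f, Ad_x δ_x g) - κ(δ'_x g, Ad_x δ_x f)`, where `δ` is the differential in the
left and `δ'` the differential in the right trivialization. -/
def poissonBracket (S : Subgroup T B) (f g : B) (x : WithConv (B →ₐ[k] k)) : k :=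
  T.bracketValue (Ad (onPoints S.res x))
    (leftDiff f x ∘ₗ S.lieEquiv.symm.toLinearMap) (rightDiff f x ∘ₗ S.lieEquiv.symm.toLinearMap)
    (leftDiff g x ∘ₗ S.lieEquiv.symm.toLinearMap) (rightDiff g x ∘ₗ S.lieEquiv.symm.toLinearMap)

end Subgroup

end AlgSetting

end

/-! Pulling `f` back along `Ψ` composes its trivialized differentials with `ψ`. Since `ψ` is the
transpose of `φ` on `k₁`, the element of `k₂` representing this covector is `φ` of the one
representing the differential of `f` (`IsTranspose.sharp_comp`). Both bracket identities thus follow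
from `κ₂(φ u, Ad_x φ v) = κ₁(u, Ad_{Ψ x} v)` for `x` in `H₂` (`form_Ad_map`, once in each setting).

This identity need not come from `Ad_x φ v = φ(Ad_{Ψ x} v)`; there is an error in `ker ψ`, but `ker
ψ` is orthogonal to `φ(g₁)`. So consider `M = {(φ v + m, v) : m ∈ ker ψ}` in `g₂ × g₁`, on which
`(z, y) ↦ κ₂(φ u, z) - κ₁(u, y)` vanishes. As `ψ ∘ φ = id` on `h₁`, one has `h₂ = φ(h₁) ⊕ ker ψ`,
and invariance of the forms makes `M` stable under `(ad w, ad ψ(w))` for `w ∈ h₂`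
(`IsTranspose.lie_mem_graph`). It remains to pass from the Lie algebra to the connected group `H₂`.

For Lie groups, the differential of `Ad` is the bracket (`exists_hasMFDerivAt_adCLM`), and the
functional composed with the action on `M` solves a linear left invariant equation with initial
value zero, so it vanishes (`eq_zero_of_hasMFDerivAt_mul`).

For algebraic groups, the functional along the orbits of `M` gives regular functions on `H₂` which
generate an ideal stable under left invariant derivations and vanishing at the unit. In
characteristic zero such an ideal lies in all powers of each maximal ideal containing it; Krull's
intersection theorem and connectedness make it zero (`ideal_eq_bot_of_leftDer_stable`). -/

noncomputable section

/-! ### Group operations in the chart at the unit. -/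

namespace LieSetting

open Filter Topology

section ChartAtOne

variable {𝕜 : Type*} [RCLike 𝕜] {E : Type*} [NormedAddCommGroup E] [NormedSpace 𝕜 E]
  {G : Type*} [TopologicalSpace G] [ChartedSpace E G] [Group G]

/-- Because `f` fixes `1`, one chart serves both source and target. -/
theorem mfderiv_one_eq_fderiv {f : G → G} (hf : MDifferentiableAt 𝓘(𝕜, E) 𝓘(𝕜, E) f 1)
    (h1 : f 1 = 1) :
    (mfderiv 𝓘(𝕜, E) 𝓘(𝕜, E) f 1 : E →L[𝕜] E) =
      fderiv 𝕜 (fun b => extChartAt 𝓘(𝕜, E) (1 : G) (f ((extChartAt 𝓘(𝕜, E) (1 : G)).symm b)))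
        (extChartAt 𝓘(𝕜, E) (1 : G) 1) := by
  rw [hf.mfderiv]
  simp only [writtenInExtChartAt, h1, ModelWithCorners.range_eq_univ, fderivWithin_univ]
  rfl

theorem mfderiv_one_eq_fderiv' {W : Type*} [NormedAddCommGroup W] [NormedSpace 𝕜 W] {f : G → W}
    (hf : MDifferentiableAt 𝓘(𝕜, E) 𝓘(𝕜, W) f 1) :
    (mfderiv 𝓘(𝕜, E) 𝓘(𝕜, W) f 1 : E →L[𝕜] W) =
      fderiv 𝕜 (fun b => f ((extChartAt 𝓘(𝕜, E) (1 : G)).symm b))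
        (extChartAt 𝓘(𝕜, E) (1 : G) 1) := by
  rw [hf.mfderiv]
  simp only [writtenInExtChartAt, ModelWithCorners.range_eq_univ, fderivWithin_univ]
  rfl

theorem hasMFDerivAt_one_iff {W : Type*} [NormedAddCommGroup W] [NormedSpace 𝕜 W] {f : G → W}
    (hf : ContinuousAt f 1) (f' : E →L[𝕜] W) :
    HasMFDerivAt 𝓘(𝕜, E) 𝓘(𝕜, W) f 1 f' ↔
      HasFDerivAt (fun b => f ((extChartAt 𝓘(𝕜, E) (1 : G)).symm b)) f'
        (extChartAt 𝓘(𝕜, E) (1 : G) 1) := by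
  unfold HasMFDerivAt
  simp only [writtenInExtChartAt, ModelWithCorners.range_eq_univ, hf, true_and]
  rw [← hasFDerivWithinAt_univ]
  rfl

variable (𝕜) in
theorem eventually_symm_extChartAt :
    ∀ᶠ g in 𝓝 (1 : G), (extChartAt 𝓘(𝕜, E) (1 : G)).symm (extChartAt 𝓘(𝕜, E) (1 : G) g) = g := by
  filter_upwards [extChartAt_source_mem_nhds (I := 𝓘(𝕜, E)) (1 : G)] with g hg
  exact (extChartAt 𝓘(𝕜, E) (1 : G)).left_inv hg

/-- A map into the group that is smooth at a point and takes it to `1` is smooth in the chart. -/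
theorem contDiffAt_chart_comp {W : Type*} [NormedAddCommGroup W] [NormedSpace 𝕜 W] {f : W → G}
    {p : W} (hf : ContMDiffAt 𝓘(𝕜, W) 𝓘(𝕜, E) ∞ f p) (h1 : f p = 1) :
    ContDiffAt 𝕜 ∞ (fun q => extChartAt 𝓘(𝕜, E) (1 : G) (f q)) p := by
  rw [← contMDiffAt_iff_contDiffAt]
  refine ContMDiffAt.comp p (g := extChartAt 𝓘(𝕜, E) (1 : G)) (I' := 𝓘(𝕜, E)) ?_ hf
  rw [h1]
  exact contMDiffAt_extChartAt

variable [LieGroup 𝓘(𝕜, E) ∞ G]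

variable (𝕜 G) in
theorem contMDiffAt_chart_symm :
    ContMDiffAt 𝓘(𝕜, E) 𝓘(𝕜, E) ∞ (extChartAt 𝓘(𝕜, E) (1 : G)).symm
      (extChartAt 𝓘(𝕜, E) (1 : G) 1) :=
  (contMDiffOn_extChartAt_symm (n := ∞) (1 : G)).contMDiffAt (extChartAt_target_mem_nhds _)

variable (𝕜 G) in
theorem contMDiffAt_fst_snd :
    ContMDiffAt 𝓘(𝕜, E × E) 𝓘(𝕜, E) ∞
      (fun q : E × E => (extChartAt 𝓘(𝕜, E) (1 : G)).symm q.1)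
      (extChartAt 𝓘(𝕜, E) (1 : G) 1, extChartAt 𝓘(𝕜, E) (1 : G) 1) ∧
    ContMDiffAt 𝓘(𝕜, E × E) 𝓘(𝕜, E) ∞
      (fun q : E × E => (extChartAt 𝓘(𝕜, E) (1 : G)).symm q.2)
      (extChartAt 𝓘(𝕜, E) (1 : G) 1, extChartAt 𝓘(𝕜, E) (1 : G) 1) := by
  have h := contMDiffAt_chart_symm 𝕜 (E := E) G
  constructor
  · exact ContMDiffAt.comp (I' := 𝓘(𝕜, E)) (f := Prod.fst) _ h contDiffAt_fst.contMDiffAt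
  · exact ContMDiffAt.comp (I' := 𝓘(𝕜, E)) (f := Prod.snd) _ h contDiffAt_snd.contMDiffAt

variable (𝕜 E G) in
/-- The multiplication in the chart at `1`. -/
def chartMul (q : E × E) : E :=
  extChartAt 𝓘(𝕜, E) (1 : G)
    ((extChartAt 𝓘(𝕜, E) (1 : G)).symm q.1 * (extChartAt 𝓘(𝕜, E) (1 : G)).symm q.2)

variable (𝕜 E G) in
/-- The left division `(x, y) ↦ x⁻¹ y` in the chart at `1`. -/
def chartDiv (q : E × E) : E :=
  extChartAt 𝓘(𝕜, E) (1 : G)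
    (((extChartAt 𝓘(𝕜, E) (1 : G)).symm q.1)⁻¹ * (extChartAt 𝓘(𝕜, E) (1 : G)).symm q.2)

variable (𝕜 E G) in
/-- The conjugation `(x, y) ↦ x y x⁻¹` in the chart at `1`. -/
def chartConj (q : E × E) : E :=
  extChartAt 𝓘(𝕜, E) (1 : G)
    ((extChartAt 𝓘(𝕜, E) (1 : G)).symm q.1 * (extChartAt 𝓘(𝕜, E) (1 : G)).symm q.2 *
      ((extChartAt 𝓘(𝕜, E) (1 : G)).symm q.1)⁻¹)

variable (𝕜 G) in
theorem contDiffAt_chartMul : ContDiffAt 𝕜 ∞ (chartMul 𝕜 E G)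
    (extChartAt 𝓘(𝕜, E) (1 : G) 1, extChartAt 𝓘(𝕜, E) (1 : G) 1) :=
  contDiffAt_chart_comp ((contMDiffAt_fst_snd 𝕜 G).1.mul (contMDiffAt_fst_snd 𝕜 G).2) (by simp)

variable (𝕜 G) in
theorem contDiffAt_chartDiv : ContDiffAt 𝕜 ∞ (chartDiv 𝕜 E G)
    (extChartAt 𝓘(𝕜, E) (1 : G) 1, extChartAt 𝓘(𝕜, E) (1 : G) 1) :=
  contDiffAt_chart_comp ((contMDiffAt_fst_snd 𝕜 G).1.inv.mul (contMDiffAt_fst_snd 𝕜 G).2)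
    (by simp)

variable (𝕜 G) in
theorem contDiffAt_chartConj : ContDiffAt 𝕜 ∞ (chartConj 𝕜 E G)
    (extChartAt 𝓘(𝕜, E) (1 : G) 1, extChartAt 𝓘(𝕜, E) (1 : G) 1) :=
  contDiffAt_chart_comp (((contMDiffAt_fst_snd 𝕜 G).1.mul (contMDiffAt_fst_snd 𝕜 G).2).mul
    (contMDiffAt_fst_snd 𝕜 G).1.inv) (by simp)

variable (𝕜 G) in
-- This is `(x y x⁻¹) x = x y`, valid where the chart can be inverted at `x y x⁻¹`. Differentiating
-- it expresses the derivative of `Ad` through the multiplication alone.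
theorem eventually_chartMul_chartConj :
    ∀ᶠ q in 𝓝 (extChartAt 𝓘(𝕜, E) (1 : G) 1, extChartAt 𝓘(𝕜, E) (1 : G) 1),
      chartMul 𝕜 E G (chartConj 𝕜 E G q, q.1) = chartMul 𝕜 E G q := by
  have hc := ((((contMDiffAt_fst_snd 𝕜 (E := E) G).1.mul (contMDiffAt_fst_snd 𝕜 G).2).mul
    (contMDiffAt_fst_snd 𝕜 G).1.inv)).continuousAt
  have h1 := hc.eventually (p := fun g => (extChartAt 𝓘(𝕜, E) (1 : G)).symm
    (extChartAt 𝓘(𝕜, E) (1 : G) g) = g) (by simpa using eventually_symm_extChartAt 𝕜 (G := G))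
  filter_upwards [h1] with q hq
  simp only [chartMul, chartConj]
  erw [hq]
  simp

end ChartAtOne

end LieSetting

/-! ### Linear left invariant differential equations on a connected group. -/

namespace LieSetting

open Filter Topology

section Uniqueness

variable {𝕜 : Type*} [RCLike 𝕜]

/-- A function whose derivative is bounded by a multiple of its value and that vanishes at a point
vanishes near that point. -/
theorem eventually_eq_zero_of_norm_fderiv_le {F W : Type*} [NormedAddCommGroup F]
    [NormedSpace 𝕜 F] [NormedAddCommGroup W] [NormedSpace 𝕜 W] {g : F → W} {g' : F → F →L[𝕜] W}
    {o : F} {K : ℝ} (hg : ∀ᶠ a in 𝓝 o, HasFDerivAt g (g' a) a)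
    (hK : ∀ᶠ a in 𝓝 o, ‖g' a‖ ≤ K * ‖g a‖) (h0 : g o = 0) : ∀ᶠ a in 𝓝 o, g a = 0 := by
  let : NormedSpace ℝ F := NormedSpace.restrictScalars ℝ 𝕜 F
  have hb : ∀ᶠ a in 𝓝 o, ‖g a‖ ≤ 1 := by
    have hc : ContinuousAt (fun a => ‖g a‖) o := hg.self_of_nhds.continuousAt.norm
    exact hc.eventually (eventually_le_nhds (by simp [h0]))
  obtain ⟨r, hr, hball⟩ := Metric.eventually_nhds_iff_ball.1 (hg.and (hK.and hb))
  -- The radius is small enough for `|K| * s ≤ 1 / 2`, so each use of the mean value inequality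
  -- halves the bound on `g`.
  set s := min r (1 / (2 * (|K| + 1)))
  have hs : 0 < s := lt_min hr (by positivity)
  have hKs : |K| * s ≤ 1 / 2 := by
    have h1 : s ≤ 1 / (2 * (|K| + 1)) := min_le_right _ _
    have h2 : (0 : ℝ) < |K| + 1 := by positivity
    calc |K| * s ≤ (|K| + 1) * (1 / (2 * (|K| + 1))) := by gcongr; linarith
      _ = 1 / 2 := by field_simp
  have hsub : Metric.ball o s ⊆ Metric.ball o r := Metric.ball_subset_ball (min_le_left _ _)
  have key : ∀ n : ℕ, ∀ a ∈ Metric.ball o s, ‖g a‖ ≤ (1 / 2) ^ n := by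
    intro n
    induction n with
    | zero => intro a ha; simpa using (hball a (hsub ha)).2.2
    | succ n ih =>
      intro a ha
      have h1 : ∀ b ∈ Metric.ball o s, ‖g' b‖ ≤ |K| * (1 / 2) ^ n := fun b hb' =>
        ((hball b (hsub hb')).2.1.trans
          (mul_le_mul_of_nonneg_right (le_abs_self K) (norm_nonneg _))).trans
          (mul_le_mul_of_nonneg_left (ih b hb') (abs_nonneg K))
      have h2 := Convex.norm_image_sub_le_of_norm_hasFDerivWithin_le (𝕜 := 𝕜)
        (fun b hb' => (hball b (hsub hb')).1.hasFDerivWithinAt) h1 (convex_ball o s)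
        (Metric.mem_ball_self hs) ha
      rw [h0, sub_zero] at h2
      rw [Metric.mem_ball, dist_eq_norm] at ha
      calc ‖g a‖ ≤ |K| * (1 / 2) ^ n * ‖a - o‖ := h2
        _ ≤ |K| * (1 / 2) ^ n * s := by gcongr
        _ = (|K| * s) * (1 / 2) ^ n := by ring
        _ ≤ 1 / 2 * (1 / 2) ^ n := by gcongr
        _ = (1 / 2) ^ (n + 1) := by ring
  filter_upwards [Metric.ball_mem_nhds o hs] with a ha
  have h3 : ‖g a‖ ≤ 0 := ge_of_tendsto'
    (tendsto_pow_atTop_nhds_zero_of_lt_one (by norm_num) (by norm_num : (1 / 2 : ℝ) < 1))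
    fun n => key n a ha
  exact norm_le_zero_iff.1 h3

variable {F : Type*} [NormedAddCommGroup F] [NormedSpace 𝕜 F]
  {H : Type*} [TopologicalSpace H] [ChartedSpace F H] [Group H] [LieGroup 𝓘(𝕜, F) ∞ H]
  {W : Type*} [NormedAddCommGroup W] [NormedSpace 𝕜 W]

/-- The hypothesis concerns derivatives at `1` only. Writing `f b = f (x * (x⁻¹ * b))` moves it to
any point of the chart, at the cost of the differential of left division on the diagonal. -/
theorem hasFDerivAt_comp_chart {f : H → W} {B : W →L[𝕜] F →L[𝕜] W}
    (hf : ∀ x, HasMFDerivAt 𝓘(𝕜, F) 𝓘(𝕜, W) (fun y => f (x * y)) 1 (B (f x))) {a : F}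
    (ha : a ∈ (extChartAt 𝓘(𝕜, F) (1 : H)).target)
    (hd : DifferentiableAt 𝕜 (chartDiv 𝕜 F H) (a, a)) :
    HasFDerivAt (fun b => f ((extChartAt 𝓘(𝕜, F) (1 : H)).symm b))
      (B (f ((extChartAt 𝓘(𝕜, F) (1 : H)).symm a)) ∘L
        (fderiv 𝕜 (chartDiv 𝕜 F H) (a, a) ∘L ContinuousLinearMap.inr 𝕜 F F)) a := by
  set x := (extChartAt 𝓘(𝕜, F) (1 : H)).symm a with hx
  have h1 := (hasMFDerivAt_one_iff (hf x).continuousAt _).1 (hf x)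
  have h2 : HasFDerivAt (fun b => chartDiv 𝕜 F H (a, b))
      (fderiv 𝕜 (chartDiv 𝕜 F H) (a, a) ∘L ContinuousLinearMap.inr 𝕜 F F) a :=
    hd.hasFDerivAt.comp a (hasFDerivAt_prodMk_right a a)
  have h3 : chartDiv 𝕜 F H (a, a) = extChartAt 𝓘(𝕜, F) (1 : H) 1 := by simp [chartDiv]
  rw [← h3] at h1
  refine (HasFDerivAt.comp a h1 h2).congr_of_eventuallyEq ?_
  have := topologicalGroup_of_lieGroup 𝓘(𝕜, F) ∞ (G := H)
  have h4 : Tendsto (fun b => x⁻¹ * (extChartAt 𝓘(𝕜, F) (1 : H)).symm b) (𝓝 a) (𝓝 1) := by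
    have h5 : ContinuousAt (extChartAt 𝓘(𝕜, F) (1 : H)).symm a := 
      continuousAt_extChartAt_symm'' (I := 𝓘(𝕜, F)) ha
    have h6 : ContinuousAt (fun b => x⁻¹ * (extChartAt 𝓘(𝕜, F) (1 : H)).symm b) a :=
      continuousAt_const.mul h5
    rwa [ContinuousAt, ← hx, inv_mul_cancel] at h6
  filter_upwards [h4.eventually (eventually_symm_extChartAt 𝕜 (E := F) (G := H))] with b hb
  simp only [chartDiv, Function.comp_apply]
  rw [← hx, hb, mul_inv_cancel_left]

/-- The differential of left division is bounded near the diagonal point by some `C`, so in the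
chart the derivative of `f` is at most `‖B‖ * C * ‖f‖`. -/
theorem eventually_eq_zero_of_hasMFDerivAt_mul {f : H → W} {B : W →L[𝕜] F →L[𝕜] W}
    (hf : ∀ x, HasMFDerivAt 𝓘(𝕜, F) 𝓘(𝕜, W) (fun y => f (x * y)) 1 (B (f x))) (h1 : f 1 = 0) :
    ∀ᶠ x in 𝓝 (1 : H), f x = 0 := by
  set o := extChartAt 𝓘(𝕜, F) (1 : H) 1 with ho
  have hd := contDiffAt_chartDiv 𝕜 (E := F) H
  have hdiag : Tendsto (fun a : F => (a, a)) (𝓝 o) (𝓝 (o, o)) :=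
    (continuous_id.prodMk continuous_id).tendsto o
  have hdiff : ∀ᶠ a in 𝓝 o, DifferentiableAt 𝕜 (chartDiv 𝕜 F H) (a, a) := by
    refine hdiag.eventually ?_
    filter_upwards [(hd.of_le (m := 1) (by simp)).eventually (by simp)] with q hq
    exact hq.differentiableAt (by simp)
  have hbd : ∃ C : ℝ, ∀ᶠ a in 𝓝 o, ‖fderiv 𝕜 (chartDiv 𝕜 F H) (a, a) ∘L
      ContinuousLinearMap.inr 𝕜 F F‖ ≤ C := by
    have hc : ContinuousAt (fun q => ‖fderiv 𝕜 (chartDiv 𝕜 F H) q ∘L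
        ContinuousLinearMap.inr 𝕜 F F‖) (o, o) :=
      ((hd.continuousAt_fderiv (by simp)).clm_comp continuousAt_const).norm
    exact ⟨_, (hc.tendsto.comp hdiag).eventually (eventually_le_nhds (lt_add_one _))⟩
  obtain ⟨C, hC⟩ := hbd
  have htar : ∀ᶠ a in 𝓝 o, a ∈ (extChartAt 𝓘(𝕜, F) (1 : H)).target :=
    extChartAt_target_mem_nhds (I := 𝓘(𝕜, F)) (1 : H)
  have key := eventually_eq_zero_of_norm_fderiv_le (K := ‖B‖ * C)
    ((htar.and hdiff).mono fun a ha => hasFDerivAt_comp_chart hf ha.1 ha.2)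
    (hC.mono fun a ha => by
      refine (ContinuousLinearMap.opNorm_comp_le _ _).trans ?_
      rw [mul_right_comm]
      exact mul_le_mul (B.le_opNorm _) ha (norm_nonneg _) (by positivity))
    (by rw [extChartAt_to_inv]; exact h1)
  have h2 := (continuousAt_extChartAt (I := 𝓘(𝕜, F)) (1 : H)).eventually key
  filter_upwards [h2, eventually_symm_extChartAt 𝕜 (E := F) (G := H)] with x hx hx'
  rwa [hx'] at hx

/-- On a connected group a solution of a linear left invariant differential equation that vanishes
at `1` vanishes everywhere. -/
theorem eq_zero_of_hasMFDerivAt_mul [ConnectedSpace H] {f : H → W} {B : W →L[𝕜] F →L[𝕜] W}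
    (hf : ∀ x, HasMFDerivAt 𝓘(𝕜, F) 𝓘(𝕜, W) (fun y => f (x * y)) 1 (B (f x))) (h1 : f 1 = 0)
    (x : H) : f x = 0 := by
  have := topologicalGroup_of_lieGroup 𝓘(𝕜, F) ∞ (G := H)
  have hlim : ∀ x₀ : H, Tendsto (fun y => x₀⁻¹ * y) (𝓝 x₀) (𝓝 1) := fun x₀ => by
    simpa using (continuous_const_mul x₀⁻¹).tendsto x₀
  have hcont : Continuous f := continuous_iff_continuousAt.2 fun x₀ => by
    have h2 := (hf x₀).continuousAt.tendsto.comp (hlim x₀)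
    simpa [Function.comp_def, ContinuousAt] using h2
  -- The left translate `y ↦ f (x₀ * y)` solves the same equation, so the local statement at `1`
  -- applies at every zero.
  have hopen : IsOpen {y | f y = 0} := isOpen_iff_mem_nhds.2 fun x₀ hx₀ => by
    have h2 := eventually_eq_zero_of_hasMFDerivAt_mul (f := fun y => f (x₀ * y)) (B := B)
      (fun y => (hf (x₀ * y)).congr_of_eventuallyEq (.of_forall fun z => by simp [mul_assoc])) (by simpa using hx₀)
    filter_upwards [(hlim x₀).eventually h2] with y hy
    simpa using hy
  have hclosed : IsClosed {y | f y = 0} := isClosed_eq hcont continuous_const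
  have huniv := IsClopen.eq_univ ⟨hclosed, hopen⟩ ⟨1, h1⟩
  exact (Set.eq_univ_iff_forall.1 huniv) x

/-- A subspace that is stable under the differential of a representation of a connected group is
stable under the group. Here the subspace is the range of the projection `π`, and `l` is a
functional that vanishes on it. -/
theorem apply_eq_zero_of_lie_stable [ConnectedSpace H] {X : Type*} [NormedAddCommGroup X]
    [NormedSpace 𝕜 X] {ρ : H → X →L[𝕜] X} (hmul : ∀ x y, ρ (x * y) = ρ x ∘L ρ y)
    (hone : ρ 1 = ContinuousLinearMap.id 𝕜 X) {ρ' : F →L[𝕜] X →L[𝕜] X}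
    (hρ : HasMFDerivAt 𝓘(𝕜, F) 𝓘(𝕜, X →L[𝕜] X) ρ 1 ρ') {π : X →L[𝕜] X}
    (hπ : ∀ w z, π (ρ' w (π z)) = ρ' w (π z)) {l : X →L[𝕜] 𝕜} (hl : ∀ z, l (π z) = 0) (x : H)
    (z : X) : l (ρ x (π z)) = 0 := by
  -- By `hπ`, `l ρ(x) ρ'(w) π = (l ρ(x) π) ρ'(w) π`. Hence `x ↦ l ρ(x) π` satisfies a linear
  -- equation in itself, with coefficient `B`.
  let B : (X →L[𝕜] 𝕜) →L[𝕜] F →L[𝕜] (X →L[𝕜] 𝕜) :=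
    ((ContinuousLinearMap.compL 𝕜 X X 𝕜).flip.comp
      (((ContinuousLinearMap.compL 𝕜 X X X).flip π).comp ρ')).flip
  have hB : ∀ u w z, B u w z = u (ρ' w (π z)) := fun u w z => rfl
  have h0 := eq_zero_of_hasMFDerivAt_mul (𝕜 := 𝕜) (f := fun x => l ∘L (ρ x ∘L π)) (B := B) ?_ ?_ x
  · exact congrArg (fun u => u z) h0
  · intro x
    let Λ : (X →L[𝕜] X) →L[𝕜] (X →L[𝕜] 𝕜) :=
      (ContinuousLinearMap.compL 𝕜 X X 𝕜 (l ∘L ρ x)).comp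
        ((ContinuousLinearMap.compL 𝕜 X X X).flip π)
    have h1 : HasMFDerivAt 𝓘(𝕜, F) 𝓘(𝕜, X →L[𝕜] 𝕜) (Λ ∘ ρ) 1 (Λ ∘L ρ') :=
      HasMFDerivAt.comp (1 : H) Λ.hasMFDerivAt hρ
    have h2 : (fun y => l ∘L (ρ (x * y) ∘L π)) = Λ ∘ ρ := by
      funext y
      ext z
      simp [Λ, hmul]
    have h3 : B (l ∘L (ρ x ∘L π)) = Λ ∘L ρ' := by
      ext w z
      simp [hB, Λ, hπ]
    rw [h2, h3]
    exact h1
  · ext z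
    simp [hone, hl]

end Uniqueness

end LieSetting

/-! ### The differential of the adjoint representation. -/

namespace LieSetting

open Filter Topology

section Adjoint

variable {𝕜 : Type*} [RCLike 𝕜] {E : Type*} [NormedAddCommGroup E] [NormedSpace 𝕜 E]
  {G : Type*} [TopologicalSpace G] [ChartedSpace E G] [Group G]

variable (𝕜 E) in
/-- The adjoint action as a continuous linear map of the model space. -/
def adCLM (y : G) : E →L[𝕜] E :=
  (mfderiv 𝓘(𝕜, E) 𝓘(𝕜, E) (fun z : G => y * z * y⁻¹) 1 :)

theorem adCLM_one : adCLM 𝕜 E (1 : G) = ContinuousLinearMap.id 𝕜 E := by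
  have h : (fun z : G => 1 * z * 1⁻¹) = id := by funext z; simp
  unfold adCLM
  rw [h, mfderiv_id]
  rfl

variable [LieGroup 𝓘(𝕜, E) ∞ G]

theorem contMDiff_conj (y : G) :
    ContMDiff 𝓘(𝕜, E) 𝓘(𝕜, E) ∞ (fun z : G => y * z * y⁻¹) :=
  (contMDiff_const.mul contMDiff_id).mul contMDiff_const

theorem mdifferentiableAt_conj (y z : G) :
    MDifferentiableAt 𝓘(𝕜, E) 𝓘(𝕜, E) (fun z : G => y * z * y⁻¹) z :=
  (contMDiff_conj (𝕜 := 𝕜) y).mdifferentiableAt (by simp)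

theorem adCLM_eq_fderiv (y : G) :
    adCLM 𝕜 E y = fderiv 𝕜 (fun b => extChartAt 𝓘(𝕜, E) (1 : G)
      (y * (extChartAt 𝓘(𝕜, E) (1 : G)).symm b * y⁻¹)) (extChartAt 𝓘(𝕜, E) (1 : G) 1) :=
  mfderiv_one_eq_fderiv (mdifferentiableAt_conj y 1) (by simp)

theorem adCLM_mul (x y : G) : adCLM 𝕜 E (x * y) = adCLM 𝕜 E x ∘L adCLM 𝕜 E y := by
  have h : (fun z : G => x * y * z * (x * y)⁻¹) =
      (fun z : G => x * z * x⁻¹) ∘ (fun z : G => y * z * y⁻¹) := by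
    funext z; simp [mul_assoc]
  have h1 : mfderiv 𝓘(𝕜, E) 𝓘(𝕜, E) (fun z : G => x * y * z * (x * y)⁻¹) 1 =
      (mfderiv 𝓘(𝕜, E) 𝓘(𝕜, E) (fun z : G => x * z * x⁻¹) (y * 1 * y⁻¹)).comp
        (mfderiv 𝓘(𝕜, E) 𝓘(𝕜, E) (fun z : G => y * z * y⁻¹) 1) := by
    rw [h]
    exact mfderiv_comp (1 : G) (mdifferentiableAt_conj x _) (mdifferentiableAt_conj y 1)
  unfold adCLM
  rw [h1, mul_one, mul_inv_cancel]
  rfl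

variable (𝕜 G) in
-- Near the unit `Ad` is a partial derivative of a smooth map, which makes it differentiable there.
theorem eventually_adCLM_symm :
    ∀ᶠ a in 𝓝 (extChartAt 𝓘(𝕜, E) (1 : G) 1),
      adCLM 𝕜 E ((extChartAt 𝓘(𝕜, E) (1 : G)).symm a) =
        fderiv 𝕜 (chartConj 𝕜 E G) (a, extChartAt 𝓘(𝕜, E) (1 : G) 1) ∘L
          ContinuousLinearMap.inr 𝕜 E E := by
  have hd := ((contDiffAt_chartConj 𝕜 (E := E) G).of_le (m := 1) (by simp)).eventually (by simp)
  filter_upwards [(Continuous.prodMk_left (extChartAt 𝓘(𝕜, E) (1 : G) 1)).tendsto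
    (extChartAt 𝓘(𝕜, E) (1 : G) 1) |>.eventually hd] with a ha
  rw [adCLM_eq_fderiv]
  exact ((ha.differentiableAt (by simp)).hasFDerivAt.comp _
    (hasFDerivAt_prodMk_right a _)).fderiv

variable (𝕜 G) in
-- In the chart a left invariant field is a partial derivative of the multiplication, so brackets of
-- such fields involve only its second derivative.
theorem eventually_mulInvariantVectorField (v : GroupLieAlgebra 𝓘(𝕜, E) G) :
    ∀ᶠ a in 𝓝 (extChartAt 𝓘(𝕜, E) (1 : G) 1),
      VectorField.mpullbackWithin 𝓘(𝕜, E) 𝓘(𝕜, E) (extChartAt 𝓘(𝕜, E) (1 : G)).symm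
        (mulInvariantVectorField v) (Set.range 𝓘(𝕜, E)) a =
        fderiv 𝕜 (chartMul 𝕜 E G) (a, extChartAt 𝓘(𝕜, E) (1 : G) 1) ((0, v) : E × E) := by
  have hd := ((contDiffAt_chartMul 𝕜 (E := E) G).of_le (m := 1) (by simp)).eventually (by simp)
  have htar : ∀ᶠ a in 𝓝 (extChartAt 𝓘(𝕜, E) (1 : G) 1),
      a ∈ (extChartAt 𝓘(𝕜, E) (1 : G)).target :=
    extChartAt_target_mem_nhds (I := 𝓘(𝕜, E)) (1 : G)
  have : IsManifold 𝓘(𝕜, E) 1 G := .of_le (n := ∞) ENat.LEInfty.out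
  filter_upwards [(Continuous.prodMk_left (extChartAt 𝓘(𝕜, E) (1 : G) 1)).tendsto
    (extChartAt 𝓘(𝕜, E) (1 : G) 1) |>.eventually hd, htar] with a ha hta
  have hL : MDifferentiableAt 𝓘(𝕜, E) 𝓘(𝕜, E)
      (fun z : G => (extChartAt 𝓘(𝕜, E) (1 : G)).symm a * z) 1 :=
    (contMDiff_mul_left (n := ∞)).mdifferentiableAt (by simp)
  have hsrc : (extChartAt 𝓘(𝕜, E) (1 : G)).symm a ∈ (chartAt E (1 : G)).source := by
    have := (extChartAt 𝓘(𝕜, E) (1 : G)).map_target hta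
    rwa [extChartAt_source] at this
  have he : MDifferentiableAt 𝓘(𝕜, E) 𝓘(𝕜, E) (extChartAt 𝓘(𝕜, E) (1 : G))
      ((extChartAt 𝓘(𝕜, E) (1 : G)).symm a * 1) := by
    rw [mul_one]
    exact mdifferentiableAt_extChartAt hsrc
  have hcomp := mfderiv_comp (1 : G) he hL
  have h1 := mfderiv_one_eq_fderiv' (he.comp (1 : G) hL)
  have h2 : fderiv 𝕜 (fun b => (extChartAt 𝓘(𝕜, E) (1 : G) ∘
      fun z : G => (extChartAt 𝓘(𝕜, E) (1 : G)).symm a * z)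
        ((extChartAt 𝓘(𝕜, E) (1 : G)).symm b)) (extChartAt 𝓘(𝕜, E) (1 : G) 1) =
      fderiv 𝕜 (chartMul 𝕜 E G) (a, extChartAt 𝓘(𝕜, E) (1 : G) 1) ∘L
        ContinuousLinearMap.inr 𝕜 E E :=
    ((ha.differentiableAt (by simp)).hasFDerivAt.comp _ (hasFDerivAt_prodMk_right a _)).fderiv
  rw [VectorField.mpullbackWithin_apply]
  have h3 : fderiv 𝕜 (chartMul 𝕜 E G) (a, extChartAt 𝓘(𝕜, E) (1 : G) 1) ((0, v) : E × E) =
      mfderiv 𝓘(𝕜, E) 𝓘(𝕜, E) (extChartAt 𝓘(𝕜, E) (1 : G))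
        ((extChartAt 𝓘(𝕜, E) (1 : G)).symm a) (mulInvariantVectorField v
          ((extChartAt 𝓘(𝕜, E) (1 : G)).symm a)) := by
    have h4 := congrArg (fun T : E →L[𝕜] E => T v) ((h2.symm.trans h1.symm).trans hcomp)
    refine Eq.trans ?_ (h4.trans ?_)
    · rfl
    · exact congrArg (fun T : E →L[𝕜] E => T (mulInvariantVectorField v
        ((extChartAt 𝓘(𝕜, E) (1 : G)).symm a)))
        (congrArg (α := G) (β := E →L[𝕜] E)
          (fun z => mfderiv 𝓘(𝕜, E) 𝓘(𝕜, E) (extChartAt 𝓘(𝕜, E) (1 : G)) z) (mul_one _))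
  -- The differentials of the chart and of its inverse are mutually inverse, so pulling back by the
  -- inverse chart is pushing forward by the chart.
  exact (congrArg (fun T => T (mulInvariantVectorField v ((extChartAt 𝓘(𝕜, E) (1 : G)).symm a)))
    (ContinuousLinearMap.inverse_eq
      (mfderivWithin_extChartAt_symm_comp_mfderiv_extChartAt (I := 𝓘(𝕜, E)) hta)
      (mfderiv_extChartAt_comp_mfderivWithin_extChartAt_symm (I := 𝓘(𝕜, E)) hta))).trans h3.symm

theorem contDiffAt_fderiv_chartMul : ContDiffAt 𝕜 1 (fderiv 𝕜 (chartMul 𝕜 E G))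
    (extChartAt 𝓘(𝕜, E) (1 : G) 1, extChartAt 𝓘(𝕜, E) (1 : G) 1) :=
  (contDiffAt_chartMul 𝕜 (E := E) G).fderiv_right
    (one_add_one_eq_two.trans_le ENat.LEInfty.out)

variable (𝕜 E G) in
/-- The second derivative of the multiplication in the chart at `1`. -/
def chartMul₂ : E × E →L[𝕜] E × E →L[𝕜] E :=
  fderiv 𝕜 (fderiv 𝕜 (chartMul 𝕜 E G))
    (extChartAt 𝓘(𝕜, E) (1 : G) 1, extChartAt 𝓘(𝕜, E) (1 : G) 1)

variable (𝕜 E G) in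
theorem chartMul₂_symm (p q : E × E) : chartMul₂ 𝕜 E G p q = chartMul₂ 𝕜 E G q p :=
  ((contDiffAt_chartMul 𝕜 (E := E) G).isSymmSndFDerivAt (by
    rw [minSmoothness_of_isRCLikeNormedField]; exact ENat.LEInfty.out)).eq p q

variable (𝕜 E G) in
theorem hasFDerivAt_fderiv_chartMul : HasFDerivAt (fderiv 𝕜 (chartMul 𝕜 E G)) (chartMul₂ 𝕜 E G)
    (extChartAt 𝓘(𝕜, E) (1 : G) 1, extChartAt 𝓘(𝕜, E) (1 : G) 1) :=
  (contDiffAt_fderiv_chartMul.differentiableAt (by simp)).hasFDerivAt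

variable (𝕜 E G) in
-- Multiplication by the unit on either side is the identity, which gives both partial derivatives.
theorem fderiv_chartMul_apply (p : E × E) : fderiv 𝕜 (chartMul 𝕜 E G)
    (extChartAt 𝓘(𝕜, E) (1 : G) 1, extChartAt 𝓘(𝕜, E) (1 : G) 1) p = p.1 + p.2 := by
  set o := extChartAt 𝓘(𝕜, E) (1 : G) 1 with ho
  have hd := ((contDiffAt_chartMul 𝕜 (E := E) G).differentiableAt (by simp)).hasFDerivAt
  have htar : ∀ᶠ a in 𝓝 o, a ∈ (extChartAt 𝓘(𝕜, E) (1 : G)).target :=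
    extChartAt_target_mem_nhds (I := 𝓘(𝕜, E)) (1 : G)
  have h1 := (hd.comp o (hasFDerivAt_prodMk_right o o)).unique
    ((hasFDerivAt_id o).congr_of_eventuallyEq (htar.mono fun a ha => by
      simp only [chartMul, Function.comp_apply, extChartAt_to_inv, one_mul, id,
        (extChartAt 𝓘(𝕜, E) (1 : G)).right_inv ha]))
  have h2 := (hd.comp (f := fun a : E => (a, o)) o (hasFDerivAt_prodMk_left o o)).unique
    ((hasFDerivAt_id o).congr_of_eventuallyEq (htar.mono fun a ha => by
      simp only [chartMul, Function.comp_apply, ho, extChartAt_to_inv, mul_one, id,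
        (extChartAt 𝓘(𝕜, E) (1 : G)).right_inv ha]))
  have h3 := congrArg (fun T : E →L[𝕜] E => T p.2) h1
  have h4 := congrArg (fun T : E →L[𝕜] E => T p.1) h2
  simp only [ContinuousLinearMap.comp_apply, ContinuousLinearMap.inr_apply,
    ContinuousLinearMap.inl_apply, ContinuousLinearMap.id_apply] at h3 h4
  rw [← ho] at h3 h4
  have h5 : p = (p.1, 0) + (0, p.2) := by simp
  conv_lhs => rw [h5, map_add]
  rw [h3, h4]

/-- The left invariant field of `u` has value `u` at the unit and derivative `chartMul₂ (v, 0) (0,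
u)` in the direction `v`; these are inserted in `DW(V) - DV(W)`. -/
theorem bracket_eq_chartMul₂ (v w : GroupLieAlgebra 𝓘(𝕜, E) G) :
    (⁅v, w⁆ : GroupLieAlgebra 𝓘(𝕜, E) G) =
      (chartMul₂ 𝕜 E G (v, 0) (0, w) - chartMul₂ 𝕜 E G (w, 0) (0, v) : E) := by
  set o := extChartAt 𝓘(𝕜, E) (1 : G) 1 with ho
  have hfield : ∀ u : E, HasFDerivAt (fun a => fderiv 𝕜 (chartMul 𝕜 E G) (a, o) ((0, u) : E × E))
      (((chartMul₂ 𝕜 E G).comp (ContinuousLinearMap.inl 𝕜 E E)).flip (0, u)) o := fun u =>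
    ((hasFDerivAt_fderiv_chartMul 𝕜 E G).comp (f := fun a : E => (a, o)) o
      (hasFDerivAt_prodMk_left o o)).clm_apply
      (hasFDerivAt_const _ _) |>.congr_fderiv (by ext; simp)
  have hV : ∀ u : E, fderivWithin 𝕜 (fun a => (VectorField.mpullbackWithin 𝓘(𝕜, E) 𝓘(𝕜, E)
      (extChartAt 𝓘(𝕜, E) (1 : G)).symm (mulInvariantVectorField (G := G) (I := 𝓘(𝕜, E)) u)
      (Set.range 𝓘(𝕜, E)) a : E)) Set.univ o =
      ((chartMul₂ 𝕜 E G).comp (ContinuousLinearMap.inl 𝕜 E E)).flip (0, u) := fun u =>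
    (congrFun fderivWithin_univ o).trans ((hfield u).congr_of_eventuallyEq (eventually_mulInvariantVectorField 𝕜 G u)).fderiv
  have hV0 : ∀ u : E, (VectorField.mpullbackWithin 𝓘(𝕜, E) 𝓘(𝕜, E)
      (extChartAt 𝓘(𝕜, E) (1 : G)).symm (mulInvariantVectorField (G := G) (I := 𝓘(𝕜, E)) u)
      (Set.range 𝓘(𝕜, E)) o : E) = u := fun u =>
    (eventually_mulInvariantVectorField 𝕜 G u).self_of_nhds.trans
      ((fderiv_chartMul_apply 𝕜 E G (0, u)).trans (zero_add u))
  have hset : ((extChartAt 𝓘(𝕜, E) (1 : G)).symm ⁻¹' Set.univ ∩ Set.range 𝓘(𝕜, E)) = Set.univ := by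
    simp
  rw [GroupLieAlgebra.bracket_def, ← VectorField.mlieBracketWithin_univ,
    VectorField.mlieBracketWithin_apply, hset]
  have hid : (mfderiv 𝓘(𝕜, E) 𝓘(𝕜, E) (extChartAt 𝓘(𝕜, E) (1 : G)) 1).inverse =
      ContinuousLinearMap.id 𝕜 E := by
    rw [mfderiv_extChartAt_self]
    exact ContinuousLinearMap.inverse_id
  refine (congrArg (fun T : E →L[𝕜] E => T _) hid).trans ?_
  change VectorField.lieBracketWithin 𝕜 (E := E) _ _ Set.univ o = _
  unfold VectorField.lieBracketWithin
  refine congrArg₂ (· - ·) ?_ ?_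
  · exact (congrArg₂ (fun (T : E →L[𝕜] E) (z : E) => T z) (hV w) (hV0 v))
  · exact (congrArg₂ (fun (T : E →L[𝕜] E) (z : E) => T z) (hV v) (hV0 w))

variable (𝕜 E G) in
theorem exists_hasFDerivAt_adCLM : ∃ A : E →L[𝕜] E →L[𝕜] E,
    HasFDerivAt (fun a => adCLM 𝕜 E ((extChartAt 𝓘(𝕜, E) (1 : G)).symm a)) A
      (extChartAt 𝓘(𝕜, E) (1 : G) 1) := by
  set o := extChartAt 𝓘(𝕜, E) (1 : G) 1 with ho
  have h1 : DifferentiableAt 𝕜 (fderiv 𝕜 (chartConj 𝕜 E G)) (o, o) :=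
    ((contDiffAt_chartConj 𝕜 (E := E) G).fderiv_right (m := 1)
      (one_add_one_eq_two.trans_le ENat.LEInfty.out)).differentiableAt
      (by simp)
  have h2 : DifferentiableAt 𝕜 (fun a => fderiv 𝕜 (chartConj 𝕜 E G) (a, o) ∘L
      ContinuousLinearMap.inr 𝕜 E E) o :=
    (h1.comp (f := fun a : E => (a, o)) o (hasFDerivAt_prodMk_left o o).differentiableAt).clm_comp
      (differentiableAt_const _)
  exact ⟨_, (h2.hasFDerivAt).congr_of_eventuallyEq (eventually_adCLM_symm 𝕜 G)⟩

variable (𝕜 G) in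
-- Derivative of `(x y x⁻¹) x = x y` in `y` at the unit, for fixed `x` near the unit.
theorem eventually_fderiv_chartMul_adCLM (w : E) :
    ∀ᶠ a in 𝓝 (extChartAt 𝓘(𝕜, E) (1 : G) 1),
      fderiv 𝕜 (chartMul 𝕜 E G) (extChartAt 𝓘(𝕜, E) (1 : G) 1, a)
        (adCLM 𝕜 E ((extChartAt 𝓘(𝕜, E) (1 : G)).symm a) w, 0) =
      fderiv 𝕜 (chartMul 𝕜 E G) (a, extChartAt 𝓘(𝕜, E) (1 : G) 1) (0, w) := by
  set o := extChartAt 𝓘(𝕜, E) (1 : G) 1 with ho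
  have hm := ((contDiffAt_chartMul 𝕜 (E := E) G).of_le (m := 1) (by simp)).eventually (by simp)
  have hc := ((contDiffAt_chartConj 𝕜 (E := E) G).of_le (m := 1) (by simp)).eventually (by simp)
  have hl : Tendsto (fun a : E => (a, o)) (𝓝 o) (𝓝 (o, o)) := (Continuous.prodMk_left o).tendsto o
  have hr : Tendsto (fun a : E => (o, a)) (𝓝 o) (𝓝 (o, o)) := (Continuous.prodMk_right o).tendsto o
  filter_upwards [hl.eventually hm, hr.eventually hm, hl.eventually hc,
    eventually_adCLM_symm 𝕜 G, hl.eventually (eventually_chartMul_chartConj 𝕜 G).eventually_nhds]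
    with a h1 h2 h3 h4 h5
  have hco : chartConj 𝕜 E G (a, o) = o := by simp [chartConj, ho]
  have d1 : HasFDerivAt (fun b => chartConj 𝕜 E G (a, b))
      (adCLM 𝕜 E ((extChartAt 𝓘(𝕜, E) (1 : G)).symm a)) o := by
    rw [h4]
    exact (h3.differentiableAt (by simp)).hasFDerivAt.comp o (hasFDerivAt_prodMk_right a o)
  have d2 := HasFDerivAt.comp (g := chartMul 𝕜 E G) o
    (by rw [hco]; exact (h2.differentiableAt (by simp)).hasFDerivAt)
    (d1.prodMk (hasFDerivAt_const a o))
  have d3 := (h1.differentiableAt (by simp)).hasFDerivAt.comp o (hasFDerivAt_prodMk_right a o)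
  have d4 := d2.unique (d3.congr_of_eventuallyEq
    (((Continuous.prodMk_right a).tendsto o).eventually h5))
  simpa using congrArg (fun T : E →L[𝕜] E => T w) d4

/-- Differentiating the preceding identity in `x` gives `A v w + m₂((0, v), (w, 0)) = m₂((v, 0), (0,
w))` with `m₂` the second derivative of the multiplication; its symmetry gives the claim. -/
theorem apply_eq_chartMul₂_of_hasFDerivAt_adCLM {A : E →L[𝕜] E →L[𝕜] E}
    (hA : HasFDerivAt (fun a => adCLM 𝕜 E ((extChartAt 𝓘(𝕜, E) (1 : G)).symm a)) A
      (extChartAt 𝓘(𝕜, E) (1 : G) 1)) (v w : E) :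
    A v w = chartMul₂ 𝕜 E G (v, 0) (0, w) - chartMul₂ 𝕜 E G (w, 0) (0, v) := by
  set o := extChartAt 𝓘(𝕜, E) (1 : G) 1 with ho
  have d0 : HasFDerivAt (fun a => adCLM 𝕜 E ((extChartAt 𝓘(𝕜, E) (1 : G)).symm a) w) (A.flip w) o :=
    (ContinuousLinearMap.apply 𝕜 E w).hasFDerivAt.comp o hA
  have d2 := ((hasFDerivAt_fderiv_chartMul 𝕜 E G).comp o
    (hasFDerivAt_prodMk_right o o)).clm_apply (d0.prodMk (hasFDerivAt_const (0 : E) o))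
  have d3 := ((hasFDerivAt_fderiv_chartMul 𝕜 E G).comp (f := fun a : E => (a, o)) o
    (hasFDerivAt_prodMk_left o o)).clm_apply (hasFDerivAt_const ((0, w) : E × E) o)
  have d4 := d2.unique (d3.congr_of_eventuallyEq (eventually_fderiv_chartMul_adCLM 𝕜 G w))
  have d5 : fderiv 𝕜 (chartMul 𝕜 E G) (o, o) (A v w, 0) +
      chartMul₂ 𝕜 E G (0, v) (adCLM 𝕜 E ((extChartAt 𝓘(𝕜, E) (1 : G)).symm o) w, 0) =
      fderiv 𝕜 (chartMul 𝕜 E G) (o, o) 0 + chartMul₂ 𝕜 E G (v, 0) (0, w) :=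
    congrArg (fun T : E →L[𝕜] E => T v) d4
  rw [fderiv_chartMul_apply, map_zero, ho, extChartAt_to_inv, adCLM_one,
    chartMul₂_symm 𝕜 E G (0, v)] at d5
  simpa [eq_sub_iff_add_eq] using d5

variable (𝕜 E G) in
/-- The differential of the adjoint representation is the bracket. -/
theorem exists_hasMFDerivAt_adCLM : ∃ A : E →L[𝕜] E →L[𝕜] E,
    HasMFDerivAt 𝓘(𝕜, E) 𝓘(𝕜, E →L[𝕜] E) (adCLM 𝕜 E (G := G)) 1 A ∧
      ∀ v w : GroupLieAlgebra 𝓘(𝕜, E) G,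
        A (show E from v) (show E from w) = (⁅v, w⁆ : GroupLieAlgebra 𝓘(𝕜, E) G) := by
  obtain ⟨A, hA⟩ := exists_hasFDerivAt_adCLM 𝕜 E G
  refine ⟨A, (hasMFDerivAt_one_iff ?_ A).2 hA, fun v w =>
    (apply_eq_chartMul₂_of_hasFDerivAt_adCLM hA v w).trans (bracket_eq_chartMul₂ v w).symm⟩
  have h1 : ContinuousAt ((fun a => adCLM 𝕜 E ((extChartAt 𝓘(𝕜, E) (1 : G)).symm a)) ∘
      extChartAt 𝓘(𝕜, E) (1 : G)) 1 :=
    ContinuousAt.comp hA.continuousAt (continuousAt_extChartAt (I := 𝓘(𝕜, E)) (1 : G))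
  refine h1.congr ?_
  filter_upwards [eventually_symm_extChartAt 𝕜 (E := E) (G := G)] with g hg
  simp only [Function.comp_apply]
  rw [hg]

end Adjoint

end LieSetting

/-! ### Linear algebra of Manin triples: the stable subspace. -/

namespace ManinTriple

section Transpose

variable {K L L' : Type*} [Field K] [LieRing L] [LieAlgebra K L] [LieRing L'] [LieAlgebra K L']
  {T : ManinTriple K L} {T' : ManinTriple K L'}

theorem form_comm (T : ManinTriple K L) (x y : L) : T.form x y = T.form y x :=
  (T.symm.eq y x).symm

theorem form_h (T : ManinTriple K L) {x y : L} (hx : x ∈ T.h) (hy : y ∈ T.h) : T.form x y = 0 :=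
  T.h_maximal_isotropic.prop x hx y hy

theorem form_k (T : ManinTriple K L) {x y : L} (hx : x ∈ T.k) (hy : y ∈ T.k) : T.form x y = 0 :=
  T.k_maximal_isotropic.prop x hx y hy

theorem exists_add (T : ManinTriple K L) (v : L) : ∃ a ∈ T.h, ∃ b ∈ T.k, v = a + b := by
  have h : v ∈ T.h.toSubmodule ⊔ T.k.toSubmodule := by
    rw [T.isCompl.sup_eq_top]; exact Submodule.mem_top
  obtain ⟨a, ha, b, hb, hab⟩ := Submodule.mem_sup.1 h
  exact ⟨a, ha, b, hb, hab.symm⟩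

theorem eq_zero_of_form (T : ManinTriple K L) {x : L} (hh : ∀ u ∈ T.h, T.form x u = 0)
    (hk : ∀ u ∈ T.k, T.form x u = 0) : x = 0 := by
  refine T.nondegenerate.1 x fun v => ?_
  obtain ⟨a, ha, b, hb, rfl⟩ := T.exists_add v
  rw [map_add, hh a ha, hk b hb, add_zero]

theorem eq_of_form_k (T : ManinTriple K L) {x y : L} (hx : x ∈ T.h) (hy : y ∈ T.h)
    (h : ∀ u ∈ T.k, T.form x u = T.form y u) : x = y := by
  refine sub_eq_zero.1 (T.eq_zero_of_form (fun u hu => ?_) fun u hu => ?_)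
  · exact T.form_h (sub_mem hx hy) hu
  · rw [map_sub, LinearMap.sub_apply, h u hu, sub_self]

theorem eq_of_form_h (T : ManinTriple K L) {x y : L} (hx : x ∈ T.k) (hy : y ∈ T.k)
    (h : ∀ u ∈ T.h, T.form x u = T.form y u) : x = y := by
  refine sub_eq_zero.1 (T.eq_zero_of_form (fun u hu => ?_) fun u hu => ?_)
  · rw [map_sub, LinearMap.sub_apply, h u hu, sub_self]
  · exact T.form_k (sub_mem hx hy) hu

theorem mem_h_of_form (T : ManinTriple K L) {x : L} (hx : ∀ u ∈ T.h, T.form x u = 0) :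
    x ∈ T.h := by
  obtain ⟨a, ha, b, hb, rfl⟩ := T.exists_add x
  have hb0 : b = 0 := T.eq_of_form_h hb (zero_mem _) fun u hu => by
    have h := hx u hu
    rw [map_add, LinearMap.add_apply, T.form_h ha hu, zero_add] at h
    rw [h, map_zero, LinearMap.zero_apply]
  rw [hb0, add_zero]
  exact ha

variable {φ : L →ₗ⁅K⁆ L'} {ψ : T'.h →ₗ⁅K⁆ T.h}

/-- On `h` both sides vanish by isotropy, so the defining relation extends from `k` to all of `L`.
In particular `ker ψ` is orthogonal to the image of `φ`. -/
theorem IsTranspose.form_eq (hψ : T.IsTranspose T' φ ψ) (hφ : T.IsMorphism T' φ) (w : T'.h)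
    (u : L) : T.form (ψ w : L) u = T'.form (w : L') (φ u) := by
  obtain ⟨a, ha, b, hb, rfl⟩ := T.exists_add u
  rw [map_add, map_add, map_add, hψ w b hb, T.form_h (ψ w).2 ha,
    T'.form_h w.2 (hφ.map_h a ha)]

/-- Follows from `φ` being isometric. It splits `h'` as `φ(h) ⊕ ker ψ`. -/
theorem IsTranspose.apply_map (hψ : T.IsTranspose T' φ ψ) (hφ : T.IsMorphism T' φ) (v : T.h) :
    ψ ⟨φ v, hφ.map_h v v.2⟩ = v := by
  refine Subtype.ext (T.eq_of_form_k (Subtype.prop _) v.2 fun u hu => ?_)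
  rw [hψ _ u hu, hφ.map_form]

variable (T' φ ψ) in
/-- The pairs `(φ v + m, v)` with `m` in the kernel of `ψ`. -/
def graph : Submodule K (L' × L) where
  carrier := {p | ∃ m : T'.h, ψ m = 0 ∧ p.1 = φ p.2 + m}
  zero_mem' := ⟨0, by simp, by simp⟩
  add_mem' := by
    rintro p q ⟨m, hm, hp⟩ ⟨n, hn, hq⟩
    refine ⟨m + n, by rw [map_add, hm, hn, add_zero], ?_⟩
    simp only [Prod.fst_add, Prod.snd_add, hp, hq, map_add, AddMemClass.coe_add]
    abel
  smul_mem' := by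
    rintro c p ⟨m, hm, hp⟩
    refine ⟨c • m, by rw [map_smul, hm, smul_zero], ?_⟩
    simp only [Prod.smul_fst, Prod.smul_snd, hp, map_smul, SetLike.val_smul, smul_add]

/-- The content is `⁅n, φ v⁆ ∈ ker ψ`. For `v` in `h` this holds because `ker ψ` is an ideal of
`h'`; for `v` in `k` it comes from invariance of the form. -/
theorem IsTranspose.lie_map_mem_graph (hψ : T.IsTranspose T' φ ψ) (hφ : T.IsMorphism T' φ)
    {n : T'.h} (hn : ψ n = 0) (v : L) : ((⁅(n : L'), φ v⁆, 0) : L' × L) ∈ graph T' φ ψ := by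
  have hker : ∀ u, T'.form (n : L') (φ u) = 0 := fun u => by
    rw [← hψ.form_eq hφ, hn]; simp
  obtain ⟨a, ha, b, hb, rfl⟩ := T.exists_add v
  have h1 : ((⁅(n : L'), φ a⁆, 0) : L' × L) ∈ graph T' φ ψ := by
    refine ⟨⁅n, ⟨φ a, hφ.map_h a ha⟩⁆, ?_, by simp⟩
    rw [LieHom.map_lie, hn, zero_lie]
  -- `h'` is its own orthogonal, and `κ'(⁅n, φ b⁆, y) = -κ'(φ b, ⁅n, y⁆)` vanishes since `⁅n, y⁆` is
  -- again in `ker ψ`.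
  have hmem : ⁅(n : L'), φ b⁆ ∈ T'.h := T'.mem_h_of_form fun y hy => by
    have h2 := hψ ⁅n, ⟨y, hy⟩⁆ b hb
    rw [LieHom.map_lie, hn, zero_lie] at h2
    rw [T'.invariant, T'.form_comm, neg_eq_zero]
    simpa using h2.symm
  have h2 : ((⁅(n : L'), φ b⁆, 0) : L' × L) ∈ graph T' φ ψ := by
    refine ⟨⟨_, hmem⟩, ?_, by simp⟩
    refine Subtype.ext (T.eq_of_form_k (Subtype.prop _) (Subtype.prop _) fun u hu => ?_)
    rw [hψ _ u hu]
    change T'.form ⁅(n : L'), φ b⁆ (φ u) = _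
    -- Invariance turns this into `κ'(n, φ ⁅b, u⁆)`, which is zero by `hker`.
    rw [← lie_skew, map_neg, LinearMap.neg_apply, T'.invariant, neg_neg,
      ← LieHom.map_lie, hker]
    simp
  have h3 := add_mem h1 h2
  simpa using h3

/-- The graph is stable under `(w, ψ w)` for `w` in `h'`. -/
theorem IsTranspose.lie_mem_graph (hψ : T.IsTranspose T' φ ψ) (hφ : T.IsMorphism T' φ)
    (w : T'.h) {p : L' × L} (hp : p ∈ graph T' φ ψ) :
    ((⁅(w : L'), p.1⁆, ⁅(ψ w : L), p.2⁆) : L' × L) ∈ graph T' φ ψ := by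
  obtain ⟨m, hm, hp⟩ := hp
  have h1 : ((⁅(w : L'), (m : L')⁆, 0) : L' × L) ∈ graph T' φ ψ := by
    refine ⟨⁅w, m⁆, ?_, by simp⟩
    rw [LieHom.map_lie, hm, lie_zero]
  -- The component of `w` in `ker ψ` along the splitting `h' = φ(h) ⊕ ker ψ`.
  have hn : ψ (w - ⟨φ (ψ w), hφ.map_h _ (ψ w).2⟩) = 0 := by
    rw [map_sub, hψ.apply_map hφ, sub_self]
  have h2 := hψ.lie_map_mem_graph hφ hn p.2
  have h3 : ((φ ⁅(ψ w : L), p.2⁆, ⁅(ψ w : L), p.2⁆) : L' × L) ∈ graph T' φ ψ :=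
    ⟨0, by simp, by simp⟩
  have h4 := add_mem (add_mem h1 h2) h3
  -- With `n` this component and `p = (φ v + m, v)`: `⁅w, φ v + m⁆ = ⁅w, m⁆ + ⁅n, φ v⁆ + φ ⁅ψ w,
  -- v⁆`.
  have h5 : ((⁅(w : L'), p.1⁆, ⁅(ψ w : L), p.2⁆) : L' × L) = (⁅(w : L'), (m : L')⁆, 0) +
      (⁅((w - ⟨φ (ψ w), hφ.map_h _ (ψ w).2⟩ : T'.h) : L'), φ p.2⁆, 0) +
      (φ ⁅(ψ w : L), p.2⁆, ⁅(ψ w : L), p.2⁆) := by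
    simp [hp]
    abel
  rw [h5]
  exact h4

theorem map_mem_graph (v : L) : ((φ v, v) : L' × L) ∈ graph T' φ ψ := ⟨0, by simp, by simp⟩

variable (T T' φ) in
/-- The functional `(z, y) ↦ κ'(φ u, z) - κ(u, y)`. -/
def pairing (u : L) : L' × L →ₗ[K] K :=
  (T'.form (φ u)).comp (LinearMap.fst K L' L) - (T.form u).comp (LinearMap.snd K L' L)

theorem pairing_apply (u : L) (p : L' × L) :
    pairing T T' φ u p = T'.form (φ u) p.1 - T.form u p.2 := rfl

/-- The terms in `v` cancel because `φ` is isometric; the term in `m` vanishes because `ker ψ` is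
orthogonal to `φ(L)`. -/
theorem IsTranspose.pairing_eq_zero (hψ : T.IsTranspose T' φ ψ) (hφ : T.IsMorphism T' φ) (u : L)
    {p : L' × L} (hp : p ∈ graph T' φ ψ) : pairing T T' φ u p = 0 := by
  obtain ⟨m, hm, hp⟩ := hp
  rw [pairing_apply, hp, map_add, hφ.map_form, T'.form_comm (φ u) m, ← hψ.form_eq hφ, hm]
  simp

/-- Under the identifications `k = h*` and `k' = h'*`, the transpose of `ψ` is `φ`. This computes
the differentials of a pulled back function. -/
theorem IsTranspose.sharp_comp (hψ : T.IsTranspose T' φ ψ) (hφ : T.IsMorphism T' φ)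
    (a : Module.Dual K T.h) :
    (T'.sharp (a ∘ₗ (ψ : T'.h →ₗ[K] T.h)) : L') = φ (T.sharp a) := by
  refine T'.eq_of_form_h (Subtype.prop _) (hφ.map_k _ (Subtype.prop _)) fun w hw => ?_
  rw [T'.form_sharp _ ⟨w, hw⟩, T'.form_comm, ← hψ.form_eq hφ ⟨w, hw⟩, T.form_comm, T.form_sharp]
  rfl

/-- Covers both brackets and both settings, leaving only the identity `hA` for the adjoint action to
be proved. -/
theorem IsTranspose.bracketValue_comp (hψ : T.IsTranspose T' φ ψ) (hφ : T.IsMorphism T' φ)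
    {A : L →ₗ[K] L} {A' : L' →ₗ[K] L'}
    (hA : ∀ u v, T'.form (φ u) (A' (φ v)) = T.form u (A v)) (a a' b b' : Module.Dual K T.h) :
    T'.bracketValue A' (a ∘ₗ (ψ : T'.h →ₗ[K] T.h)) (a' ∘ₗ (ψ : T'.h →ₗ[K] T.h))
      (b ∘ₗ (ψ : T'.h →ₗ[K] T.h)) (b' ∘ₗ (ψ : T'.h →ₗ[K] T.h)) = T.bracketValue A a a' b b' := by
  simp only [bracketValue, hψ.sharp_comp hφ, hA]

end Transpose

end ManinTriple

/-! ### Differentials of homomorphisms and of pulled back functions. -/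

namespace LieSetting

section Application

variable {𝕜 : Type*} [RCLike 𝕜]
  {E : Type*} [NormedAddCommGroup E] [NormedSpace 𝕜 E]
  {F : Type*} [NormedAddCommGroup F] [NormedSpace 𝕜 F]
  {F' : Type*} [NormedAddCommGroup F'] [NormedSpace 𝕜 F']
  {G : Type*} [TopologicalSpace G] [ChartedSpace E G] [Group G]
  {H : Type*} [TopologicalSpace H] [ChartedSpace F H] [Group H]
  {H' : Type*} [TopologicalSpace H'] [ChartedSpace F' H'] [Group H']

variable (𝕜 F E) in
/-- The differential at `1` of a homomorphism, as a map of the model spaces. -/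
def homDiff (θ : H →* G) : F →L[𝕜] E :=
  (mfderiv 𝓘(𝕜, F) 𝓘(𝕜, E) θ 1 :)

theorem homDiff_comp {θ : H →* G} {η : H' →* H} (hθ : ContMDiff 𝓘(𝕜, F) 𝓘(𝕜, E) ∞ θ)
    (hη : ContMDiff 𝓘(𝕜, F') 𝓘(𝕜, F) ∞ η) :
    homDiff 𝕜 E F' (θ.comp η) = homDiff 𝕜 E F θ ∘L homDiff 𝕜 F F' η := by
  have h := mfderiv_comp (1 : H') (g := θ) (f := η) (hθ.mdifferentiableAt (by simp))
    (hη.mdifferentiableAt (by simp))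
  refine Eq.trans h (congrArg (fun T : F →L[𝕜] E => T ∘L homDiff 𝕜 F F' η) ?_)
  exact congrArg (α := H) (β := F →L[𝕜] E) (fun z => mfderiv 𝓘(𝕜, F) 𝓘(𝕜, E) θ z) η.map_one

theorem hasMFDerivAt_one_prodMk {W W' : Type*} [NormedAddCommGroup W] [NormedSpace 𝕜 W]
    [NormedAddCommGroup W'] [NormedSpace 𝕜 W'] {f : H → W} {g : H → W'} {f' : F →L[𝕜] W}
    {g' : F →L[𝕜] W'} (hf : HasMFDerivAt 𝓘(𝕜, F) 𝓘(𝕜, W) f 1 f')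
    (hg : HasMFDerivAt 𝓘(𝕜, F) 𝓘(𝕜, W') g 1 g') :
    HasMFDerivAt 𝓘(𝕜, F) 𝓘(𝕜, W × W') (fun x => (f x, g x)) 1 (f'.prod g') :=
  (hasMFDerivAt_one_iff (hf.continuousAt.prodMk hg.continuousAt) _).2
    (((hasMFDerivAt_one_iff hf.continuousAt _).1 hf).prodMk
      ((hasMFDerivAt_one_iff hg.continuousAt _).1 hg))

theorem hasMFDerivAt_adCLM_comp {A : E →L[𝕜] E →L[𝕜] E}
    (hA : HasMFDerivAt 𝓘(𝕜, E) 𝓘(𝕜, E →L[𝕜] E) (adCLM 𝕜 E (G := G)) 1 A) {θ : H →* G}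
    (hθ : ContMDiff 𝓘(𝕜, F) 𝓘(𝕜, E) ∞ θ) :
    HasMFDerivAt 𝓘(𝕜, F) 𝓘(𝕜, E →L[𝕜] E) (fun x => adCLM 𝕜 E (θ x)) 1 (A ∘L homDiff 𝕜 E F θ) := by
  have h1 : ∀ g : G, g = 1 → HasMFDerivAt 𝓘(𝕜, E) 𝓘(𝕜, E →L[𝕜] E) (adCLM 𝕜 E (G := G)) g A := by
    rintro _ rfl; exact hA
  exact HasMFDerivAt.comp (1 : H) (h1 (θ 1) θ.map_one)
    (hθ.mdifferentiableAt (by simp)).hasMFDerivAt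

theorem leftDiff_comp [LieGroup 𝓘(𝕜, F) ∞ H] {f : H → 𝕜} {θ : H' →* H} {x : H'}
    (hf : MDifferentiableAt 𝓘(𝕜, F) 𝓘(𝕜, 𝕜) f (θ x))
    (hθ : ContMDiff 𝓘(𝕜, F') 𝓘(𝕜, F) ∞ θ) (w : F') :
    leftDiff 𝕜 (f ∘ θ) x w = leftDiff 𝕜 f (θ x) (homDiff 𝕜 F F' θ w) := by
  have h1 : (fun y => (f ∘ θ) (x * y)) = (fun z => f (θ x * z)) ∘ θ := by
    funext y; simp
  have h2 : MDifferentiableAt 𝓘(𝕜, F) 𝓘(𝕜, 𝕜) (fun z => f (θ x * z)) (θ 1) := by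
    rw [θ.map_one]
    refine MDifferentiableAt.comp (1 : H) (g := f) (by rwa [mul_one]) ?_
    exact (contMDiff_mul_left (n := ∞)).mdifferentiableAt (by simp)
  have h3 : (mfderiv 𝓘(𝕜, F') 𝓘(𝕜, 𝕜) (fun y => (f ∘ θ) (x * y)) 1 : F' →L[𝕜] 𝕜) =
      (mfderiv 𝓘(𝕜, F) 𝓘(𝕜, 𝕜) (fun z => f (θ x * z)) (θ 1) : F →L[𝕜] 𝕜) ∘L homDiff 𝕜 F F' θ := by
    rw [h1]
    exact mfderiv_comp (1 : H') h2 (hθ.mdifferentiableAt (by simp))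
  rw [θ.map_one] at h3
  exact congrArg (fun T : F' →L[𝕜] 𝕜 => T w) h3

theorem rightDiff_comp [LieGroup 𝓘(𝕜, F) ∞ H] {f : H → 𝕜} {θ : H' →* H} {x : H'}
    (hf : MDifferentiableAt 𝓘(𝕜, F) 𝓘(𝕜, 𝕜) f (θ x))
    (hθ : ContMDiff 𝓘(𝕜, F') 𝓘(𝕜, F) ∞ θ) (w : F') :
    rightDiff 𝕜 (f ∘ θ) x w = rightDiff 𝕜 f (θ x) (homDiff 𝕜 F F' θ w) := by
  have h1 : (fun y => (f ∘ θ) (y * x)) = (fun z => f (z * θ x)) ∘ θ := by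
    funext y; simp
  have h2 : MDifferentiableAt 𝓘(𝕜, F) 𝓘(𝕜, 𝕜) (fun z => f (z * θ x)) (θ 1) := by
    rw [θ.map_one]
    refine MDifferentiableAt.comp (1 : H) (g := f) (by rwa [one_mul]) ?_
    exact (contMDiff_mul_right (n := ∞)).mdifferentiableAt (by simp)
  have h3 : (mfderiv 𝓘(𝕜, F') 𝓘(𝕜, 𝕜) (fun y => (f ∘ θ) (y * x)) 1 : F' →L[𝕜] 𝕜) =
      (mfderiv 𝓘(𝕜, F) 𝓘(𝕜, 𝕜) (fun z => f (z * θ x)) (θ 1) : F →L[𝕜] 𝕜) ∘L homDiff 𝕜 F F' θ := by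
    rw [h1]
    exact mfderiv_comp (1 : H') h2 (hθ.mdifferentiableAt (by simp))
  rw [θ.map_one] at h3
  exact congrArg (fun T : F' →L[𝕜] 𝕜 => T w) h3

end Application

/-! ### The lemma for real and complex Lie groups. -/

section Morphism

variable {𝕜 : Type*} [RCLike 𝕜]
  {E₁ E₂ F₁ F₂ : Type*}
  [NormedAddCommGroup E₁] [NormedSpace 𝕜 E₁] [FiniteDimensional 𝕜 E₁] [CompleteSpace E₁]
  [NormedAddCommGroup E₂] [NormedSpace 𝕜 E₂] [FiniteDimensional 𝕜 E₂] [CompleteSpace E₂]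
  [NormedAddCommGroup F₁] [NormedSpace 𝕜 F₁] [NormedAddCommGroup F₂] [NormedSpace 𝕜 F₂]
  {G₁ G₂ H₁ H₂ : Type*}
  [TopologicalSpace G₁] [ChartedSpace E₁ G₁] [Group G₁] [LieGroup 𝓘(𝕜, E₁) ∞ G₁]
  [TopologicalSpace G₂] [ChartedSpace E₂ G₂] [Group G₂] [LieGroup 𝓘(𝕜, E₂) ∞ G₂]
  [TopologicalSpace H₁] [ChartedSpace F₁ H₁] [Group H₁]
  [TopologicalSpace H₂] [ChartedSpace F₂ H₂] [Group H₂] [LieGroup 𝓘(𝕜, F₂) ∞ H₂]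
  [ConnectedSpace H₂]
  {T₁ : ManinTriple 𝕜 (GroupLieAlgebra 𝓘(𝕜, E₁) G₁)}
  {T₂ : ManinTriple 𝕜 (GroupLieAlgebra 𝓘(𝕜, E₂) G₂)}
  {S₁ : LieSetting.Subgroup T₁ F₁ H₁} {S₂ : LieSetting.Subgroup T₂ F₂ H₂}
  {φ : GroupLieAlgebra 𝓘(𝕜, E₁) G₁ →ₗ⁅𝕜⁆ GroupLieAlgebra 𝓘(𝕜, E₂) G₂}
  {ψ : T₂.h →ₗ⁅𝕜⁆ T₁.h} {Ψ : H₂ →* H₁}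

/-- The forms of `φ v` and `Ad_x (φ v)` correspond to those of `v` and `Ad_{Ψ x} v`. -/
theorem form_Ad_map (hφ : T₁.IsMorphism T₂ φ) (hψ : T₁.IsTranspose T₂ φ ψ)
    (hΨ : ContMDiff 𝓘(𝕜, F₂) 𝓘(𝕜, F₁) ∞ Ψ)
    (hΨψ : ∀ w : GroupLieAlgebra 𝓘(𝕜, F₂) H₂,
      S₁.lieEquiv (mfderiv 𝓘(𝕜, F₂) 𝓘(𝕜, F₁) Ψ 1 w) = ψ (S₂.lieEquiv w)) (x : H₂)
    (u v : GroupLieAlgebra 𝓘(𝕜, E₁) G₁) :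
    T₂.form (φ u) (Ad 𝕜 (S₂.incl x) (φ v)) = T₁.form u (Ad 𝕜 (S₁.incl (Ψ x)) v) := by
  obtain ⟨A₁, hA₁, hb₁⟩ := exists_hasMFDerivAt_adCLM 𝕜 E₁ G₁
  obtain ⟨A₂, hA₂, hb₂⟩ := exists_hasMFDerivAt_adCLM 𝕜 E₂ G₂
  have hd₁ := hasMFDerivAt_adCLM_comp hA₁ (θ := S₁.incl.comp Ψ) (S₁.contMDiff_incl.comp hΨ)
  have hd₂ := hasMFDerivAt_adCLM_comp hA₂ S₂.contMDiff_incl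
  let Q : ((E₂ →L[𝕜] E₂) × (E₁ →L[𝕜] E₁)) →L[𝕜] (E₂ × E₁ →L[𝕜] E₂ × E₁) :=
    ContinuousLinearMap.prodMapL 𝕜 E₂ E₂ E₁ E₁
  -- The representation `y ↦ (Ad_y, Ad_{Ψ y})` of `H₂` on `g₂ × g₁`.
  let ρ : H₂ → (E₂ × E₁ →L[𝕜] E₂ × E₁) := fun y =>
    Q (adCLM 𝕜 E₂ (S₂.incl y), adCLM 𝕜 E₁ ((S₁.incl.comp Ψ) y))
  let ρ' : F₂ →L[𝕜] (E₂ × E₁ →L[𝕜] E₂ × E₁) :=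
    Q ∘L ((A₂ ∘L homDiff 𝕜 E₂ F₂ S₂.incl).prod (A₁ ∘L homDiff 𝕜 E₁ F₂ (S₁.incl.comp Ψ)))
  have hρ : HasMFDerivAt 𝓘(𝕜, F₂) 𝓘(𝕜, E₂ × E₁ →L[𝕜] E₂ × E₁) ρ 1 ρ' :=
    HasMFDerivAt.comp (1 : H₂) Q.hasMFDerivAt (hasMFDerivAt_one_prodMk hd₂ hd₁)
  let M : Submodule 𝕜 (E₂ × E₁) := ManinTriple.graph T₂ φ ψ
  -- A linear projection onto `M`; finite dimension makes it continuous.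
  obtain ⟨p, hp⟩ := M.subtype.exists_leftInverse_of_injective (by simp)
  let π : E₂ × E₁ →L[𝕜] E₂ × E₁ := (M.subtype ∘ₗ p).toContinuousLinearMap
  have hπM : ∀ z, π z ∈ M := fun z => (p z).2
  have hπ : ∀ z ∈ M, π z = z := fun z hz =>
    congrArg Subtype.val (congrArg (fun T : M →ₗ[𝕜] M => T ⟨z, hz⟩) hp)
  let l : E₂ × E₁ →L[𝕜] 𝕜 :=
    LinearMap.toContinuousLinearMap (E := E₂ × E₁) (ManinTriple.pairing T₁ T₂ φ u)
  have hl : ∀ z ∈ M, l z = 0 := fun z hz => hψ.pairing_eq_zero hφ u hz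
  -- The differential of the representation is `(ad w, ad ψ(w))`, so stability is the infinitesimal
  -- statement for the graph.
  have hstab : ∀ w, ∀ z ∈ M, ρ' w z ∈ M := fun w z hz => by
    have h1 := hψ.lie_mem_graph hφ (S₂.lieEquiv w) hz
    have h2 : ρ' w z = (⁅(S₂.lieEquiv w : GroupLieAlgebra 𝓘(𝕜, E₂) G₂),
          (show GroupLieAlgebra 𝓘(𝕜, E₂) G₂ from z.1)⁆,
        ⁅(ψ (S₂.lieEquiv w) : GroupLieAlgebra 𝓘(𝕜, E₁) G₁),
          (show GroupLieAlgebra 𝓘(𝕜, E₁) G₁ from z.2)⁆) := by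
      refine Prod.ext ((hb₂ _ _).trans (congrArg (fun y : GroupLieAlgebra 𝓘(𝕜, E₂) G₂ =>
        ⁅y, (show GroupLieAlgebra 𝓘(𝕜, E₂) G₂ from z.1)⁆) (S₂.lieEquiv_apply w).symm))
        ((hb₁ _ _).trans (congrArg (fun y : GroupLieAlgebra 𝓘(𝕜, E₁) G₁ =>
        ⁅y, (show GroupLieAlgebra 𝓘(𝕜, E₁) G₁ from z.2)⁆) ?_))
      exact (congrArg (fun T : F₂ →L[𝕜] E₁ => T w) (homDiff_comp S₁.contMDiff_incl hΨ)).trans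
        ((S₁.lieEquiv_apply _).symm.trans (congrArg Subtype.val (hΨψ w)))
    rw [h2]
    exact h1
  have hmul : ∀ y z, ρ (y * z) = ρ y ∘L ρ z := fun y z => by
    simp only [ρ, map_mul, adCLM_mul]
    rfl
  have hone : ρ 1 = ContinuousLinearMap.id 𝕜 (E₂ × E₁) := by
    simp only [ρ, map_one, adCLM_one]
    rfl
  have key := apply_eq_zero_of_lie_stable hmul hone hρ (π := π) (l := l)
    (fun w z => hπ _ (hstab w _ (hπM z))) (fun z => hl _ (hπM z)) x (φ v, v)
  have hv : π (φ v, v) = (φ v, v) := hπ _ (ManinTriple.map_mem_graph v)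
  exact sub_eq_zero.1 ((congrArg (fun z => l (ρ x z)) hv).symm.trans key)

theorem bracketValue_comp [LieGroup 𝓘(𝕜, F₁) ∞ H₁]
    (hφ : T₁.IsMorphism T₂ φ) (hψ : T₁.IsTranspose T₂ φ ψ)
    (hΨ : ContMDiff 𝓘(𝕜, F₂) 𝓘(𝕜, F₁) ∞ Ψ)
    (hΨψ : ∀ w : GroupLieAlgebra 𝓘(𝕜, F₂) H₂,
      S₁.lieEquiv (mfderiv 𝓘(𝕜, F₂) 𝓘(𝕜, F₁) Ψ 1 w) = ψ (S₂.lieEquiv w)) {f g : H₁ → 𝕜} {x : H₂}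
    (hf : MDifferentiableAt 𝓘(𝕜, F₁) 𝓘(𝕜, 𝕜) f (Ψ x))
    (hg : MDifferentiableAt 𝓘(𝕜, F₁) 𝓘(𝕜, 𝕜) g (Ψ x)) :
    S₂.poissonBracket (f ∘ Ψ) (g ∘ Ψ) x = S₁.poissonBracket f g (Ψ x) ∧
      S₂.leftBracket (f ∘ Ψ) (g ∘ Ψ) x = S₁.leftBracket f g (Ψ x) := by
  have hsymm : ∀ w : T₂.h, homDiff 𝕜 F₁ F₂ Ψ (S₂.lieEquiv.symm w) = S₁.lieEquiv.symm (ψ w) := fun w => by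
    refine S₁.lieEquiv.injective ?_
    rw [LinearEquiv.apply_symm_apply]
    exact (hΨψ _).trans (congrArg ψ (S₂.lieEquiv.apply_symm_apply w))
  have hL : ∀ f : H₁ → 𝕜, MDifferentiableAt 𝓘(𝕜, F₁) 𝓘(𝕜, 𝕜) f (Ψ x) →
      leftDiff 𝕜 (f ∘ Ψ) x ∘ₗ S₂.lieEquiv.symm.toLinearMap =
        (leftDiff 𝕜 f (Ψ x) ∘ₗ S₁.lieEquiv.symm.toLinearMap) ∘ₗ (ψ : T₂.h →ₗ[𝕜] T₁.h) :=
    fun f hf => LinearMap.ext fun w => (leftDiff_comp hf hΨ _).trans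
      (congrArg (leftDiff 𝕜 f (Ψ x)) (hsymm w))
  have hR : ∀ f : H₁ → 𝕜, MDifferentiableAt 𝓘(𝕜, F₁) 𝓘(𝕜, 𝕜) f (Ψ x) →
      rightDiff 𝕜 (f ∘ Ψ) x ∘ₗ S₂.lieEquiv.symm.toLinearMap =
        (rightDiff 𝕜 f (Ψ x) ∘ₗ S₁.lieEquiv.symm.toLinearMap) ∘ₗ (ψ : T₂.h →ₗ[𝕜] T₁.h) :=
    fun f hf => LinearMap.ext fun w => (rightDiff_comp hf hΨ _).trans
      (congrArg (rightDiff 𝕜 f (Ψ x)) (hsymm w))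
  unfold Subgroup.poissonBracket Subgroup.leftBracket
  rw [hL f hf, hL g hg, hR f hf, hR g hg]
  exact ⟨hψ.bracketValue_comp hφ (form_Ad_map hφ hψ hΨ hΨψ x) _ _ _ _,
    hψ.bracketValue_comp hφ (form_Ad_map hφ hψ hΨ hΨψ x) _ _ _ _⟩

end Morphism

end LieSetting

/-! ### Commutative algebra: ideals stable under derivations. -/

namespace AlgSetting

section PointsOfAlgebras

variable {k B : Type*} [Field k] [CommRing B] [Algebra k B]

/-- If the Euler operator `∑ bᵢ ∂ᵢ` is the identity on `m / m²`, it is multiplication by `n` on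
`m ^ n / m ^ (n + 1)`. -/
theorem euler_sub_mem_pow {m : Ideal B} {ι : Type*} [Fintype ι] {b : ι → B} (hb : ∀ i, b i ∈ m)
    {D : ι → Derivation k B B} (hE : ∀ f ∈ m, ∑ i, b i * D i f - f ∈ m ^ 2) (n : ℕ) {f : B}
    (hf : f ∈ m ^ n) : ∑ i, b i * D i f - n * f ∈ m ^ (n + 1) := by
  induction n generalizing f with
  | zero => simpa using sum_mem fun i _ => Ideal.mul_mem_right _ _ (hb i)
  | succ n ih =>
    rw [pow_succ] at hf
    refine Submodule.mul_induction_on hf (fun a ha c hc => ?_) fun a c ha hc => ?_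
    -- Leibniz rule for the Euler operator on a product with `a ∈ m ^ n` and `c ∈ m`.
    · have h1 : ∑ i, b i * D i (a * c) - (n + 1 : ℕ) * (a * c) =
          a * (∑ i, b i * D i c - c) + (∑ i, b i * D i a - n * a) * c := by
        simp only [Derivation.leibniz, smul_eq_mul, mul_add, Finset.sum_add_distrib]
        rw [mul_sub, sub_mul, Finset.mul_sum, Finset.sum_mul]
        have e1 : ∀ i, b i * (a * D i c) = a * (b i * D i c) := fun i => by ring
        have e2 : ∀ i, b i * (c * D i a) = b i * D i a * c := fun i => by ring
        simp only [e1, e2]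
        push_cast
        ring
      rw [h1]
      refine add_mem ?_ ?_
      · have h2 := Ideal.mul_mem_mul ha (hE c hc)
        rwa [← pow_add] at h2
      · have h2 := Ideal.mul_mem_mul (ih ha) hc
        rwa [← pow_succ] at h2
    · have h1 : ∑ i, b i * D i (a + c) - (n + 1 : ℕ) * (a + c) =
          (∑ i, b i * D i a - (n + 1 : ℕ) * a) + (∑ i, b i * D i c - (n + 1 : ℕ) * c) := by
        simp only [map_add, mul_add, Finset.sum_add_distrib]
        ring
      rw [h1]
      exact add_mem ha hc

/-- In characteristic zero an ideal that is contained in `m` and stable under enough derivations is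
contained in all powers of `m`. -/
theorem le_pow_of_derivation_stable [CharZero k] {m I : Ideal B} {ι : Type*} [Fintype ι]
    {b : ι → B} (hb : ∀ i, b i ∈ m) {D : ι → Derivation k B B}
    (hE : ∀ f ∈ m, ∑ i, b i * D i f - f ∈ m ^ 2) (hI : I ≤ m) (hD : ∀ i, ∀ f ∈ I, D i f ∈ I)
    (n : ℕ) : I ≤ m ^ n := by
  induction n with
  | zero => simp
  | succ n ih =>
    -- The step from `n` to `n + 1` divides by `n`, so the step from `0` uses `I ≤ m` instead.
    rcases eq_or_ne n 0 with rfl | hn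
    · simpa using hI
    intro f hf
    -- Modulo `m ^ (n + 1)`, `n * f` equals `∑ bᵢ Dᵢ f`, which lies in `m * I` and hence in `m ^ (n
    -- + 1)`.
    have h1 := euler_sub_mem_pow hb hE n (ih hf)
    have h2 : ∑ i, b i * D i f ∈ m ^ (n + 1) := by
      rw [pow_succ']
      exact sum_mem fun i _ => Ideal.mul_mem_mul (hb i) (ih (hD i f hf))
    have h3 := sub_mem h2 h1
    rw [sub_sub_cancel] at h3
    have hu : algebraMap k B (n : k)⁻¹ * (n * f) = f := by
      have h4 : algebraMap k B (n : k)⁻¹ * (n : B) = 1 := by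
        rw [← map_natCast (algebraMap k B) n, ← map_mul, inv_mul_cancel₀ (Nat.cast_ne_zero.2 hn),
          map_one]
      rw [← mul_assoc, h4, one_mul]
    rw [← hu]
    exact Ideal.mul_mem_left _ _ h3

theorem sub_algebraMap_mem_ker (x : B →ₐ[k] k) (f : B) :
    f - algebraMap k B (x f) ∈ RingHom.ker x := by
  simp [RingHom.mem_ker]

/-- Spanned by `1` and finitely many generators of `m_x`: on `m_x / m_x²` a function acts through
its value at `x`. -/
theorem finite_quotient_ker_sq [IsNoetherianRing B] (x : B →ₐ[k] k) :
    Module.Finite k (B ⧸ RingHom.ker x ^ 2) := by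
  obtain ⟨S, hS⟩ := (isNoetherianRing_iff_ideal_fg B).1 inferInstance (RingHom.ker x)
  set q := (Ideal.Quotient.mkₐ k (RingHom.ker x ^ 2)).toLinearMap with hq
  set N : Submodule k (B ⧸ RingHom.ker x ^ 2) := Submodule.span k (q '' (insert 1 S : Set B))
  have hSN : ∀ f ∈ (S : Set B), q f ∈ N := fun f hf =>
    Submodule.subset_span ⟨f, Set.mem_insert_of_mem _ hf, rfl⟩
  have hm : ∀ f ∈ RingHom.ker x, q f ∈ N := by
    intro f hf
    rw [← hS] at hf
    induction hf using Submodule.span_induction with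
    | mem f hf => exact hSN f hf
    | zero => simp
    | add f g _ _ ihf ihg => rw [map_add]; exact add_mem ihf ihg
    | smul a f hf ih =>
      have hf' : f ∈ RingHom.ker x := by rw [← hS]; exact hf
      have h1 : a • f = x a • f + (a - algebraMap k B (x a)) * f := by
        rw [smul_eq_mul, Algebra.smul_def]; ring
      have h2 : q ((a - algebraMap k B (x a)) * f) = 0 := by
        refine Ideal.Quotient.eq_zero_iff_mem.2 ?_
        rw [pow_two]
        exact Ideal.mul_mem_mul (sub_algebraMap_mem_ker x a) hf'
      rw [h1, map_add, h2, add_zero, map_smul]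
      exact N.smul_mem _ ih
  have htop : N = ⊤ := by
    refine eq_top_iff.2 fun z _ => ?_
    obtain ⟨f, rfl⟩ := Ideal.Quotient.mkₐ_surjective k (RingHom.ker x ^ 2) z
    have h1 : f = x f • 1 + (f - algebraMap k B (x f)) := by
      rw [Algebra.smul_def]; ring
    have h2 : q f ∈ N := by
      rw [h1, map_add, map_smul]
      exact add_mem (N.smul_mem _ (Submodule.subset_span ⟨1, Set.mem_insert _ _, rfl⟩))
        (hm _ (sub_algebraMap_mem_ker x f))
    exact h2
  refine ⟨htop ▸ Submodule.fg_span ?_⟩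
  exact ((S.finite_toSet.insert 1).image _)

/-- Every function is determined modulo `m_x²` by its value and finitely many derivations at the
point `x`. -/
theorem exists_point_derivations [IsNoetherianRing B] (x : B →ₐ[k] k) :
    ∃ (n : ℕ) (l : Fin n → B →ₗ[k] k) (b : Fin n → B),
      (∀ i f g, l i (f * g) = x f * l i g + l i f * x g) ∧ (∀ i, b i ∈ RingHom.ker x) ∧
      ∀ f, ∑ i, l i f • b i - (f - algebraMap k B (x f)) ∈ RingHom.ker x ^ 2 := by
  have := finite_quotient_ker_sq x
  set q := (Ideal.Quotient.mkₐ k (RingHom.ker x ^ 2)).toLinearMap with hq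
  let β := Module.finBasis k (B ⧸ RingHom.ker x ^ 2)
  choose c hc using fun i => Ideal.Quotient.mkₐ_surjective k (RingHom.ker x ^ 2) (β i)
  -- The projection `f ↦ f - f(x)` onto `m_x`. The `l i` are coordinates of its class modulo `m_x²`.
  let r : B →ₗ[k] B := LinearMap.id - Algebra.linearMap k B ∘ₗ x.toLinearMap
  have hr : ∀ f, r f = f - algebraMap k B (x f) := fun f => rfl
  let l : Fin _ → B →ₗ[k] k := fun i => β.coord i ∘ₗ q ∘ₗ r
  have hsq : RingHom.ker x ^ 2 ≤ RingHom.ker x := Ideal.pow_le_self two_ne_zero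
  have hmain : ∀ f, ∑ i, l i f • c i - (f - algebraMap k B (x f)) ∈ RingHom.ker x ^ 2 := fun f => by
    refine Ideal.Quotient.eq_zero_iff_mem.1 ?_
    change q _ = 0
    rw [map_sub, map_sum, sub_eq_zero, ← hr]
    simp only [map_smul]
    have h1 : ∀ i, q (c i) = β i := hc
    simp only [h1]
    exact β.sum_repr (q (r f))
  refine ⟨_, l, fun i => r (c i), fun i f g => ?_, fun i => sub_algebraMap_mem_ker x _,
    fun f => ?_⟩
  · have h1 : r (f * g) = x f • r g + x g • r f + r f * r g := by
      simp only [hr, Algebra.smul_def, map_mul]; ring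
    have h2 : q (r f * r g) = 0 := by
      refine Ideal.Quotient.eq_zero_iff_mem.2 ?_
      rw [pow_two]
      exact Ideal.mul_mem_mul (sub_algebraMap_mem_ker x f) (sub_algebraMap_mem_ker x g)
    simp only [l, LinearMap.comp_apply, h1, map_add, h2, map_zero, map_smul, smul_eq_mul]
    ring
  -- Replacing `c i` by `r (c i)`, which lies in `m_x`, costs nothing: the error term already
  -- vanishes at `x`, so `r` fixes it.
  · have h1 : r (∑ i, l i f • c i - (f - algebraMap k B (x f))) =
        ∑ i, l i f • r (c i) - (f - algebraMap k B (x f)) := by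
      rw [map_sub, map_sum]
      simp only [map_smul]
      congr 1
      simp [hr]
    have h2 : x (∑ i, l i f • c i - (f - algebraMap k B (x f))) = 0 := hsq (hmain f)
    rw [← h1, hr, h2, map_zero, sub_zero]
    exact hmain f

/-- Nullstellensatz: the residue field is finite over the algebraically closed field `k`, hence
equal to it. -/
theorem exists_point_ker_eq [IsAlgClosed k] [Algebra.FiniteType k B] (m : Ideal B)
    [hm : m.IsMaximal] : ∃ x : B →ₐ[k] k, RingHom.ker x = m := by
  let := Ideal.Quotient.field m
  have : Module.Finite k (B ⧸ m) := finite_of_finite_type_of_isJacobsonRing k (B ⧸ m)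
  have hbij : Function.Bijective (algebraMap k (B ⧸ m)) :=
    IsAlgClosed.algebraMap_bijective_of_isIntegral
  let e : k ≃ₐ[k] (B ⧸ m) := AlgEquiv.ofBijective (Algebra.ofId k (B ⧸ m)) hbij
  refine ⟨(e.symm : (B ⧸ m) →ₐ[k] k).comp (Ideal.Quotient.mkₐ k m), ?_⟩
  ext f
  simp [RingHom.mem_ker, Ideal.Quotient.eq_zero_iff_mem]

theorem exists_mul_eq_self_of_mem_iInf_pow [IsNoetherianRing B] (m : Ideal B) {f : B}
    (hf : ∀ n : ℕ, f ∈ m ^ n) : ∃ r ∈ m, r * f = f := by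
  have h1 : f ∈ (⨅ i : ℕ, m ^ i • ⊤ : Submodule B B) := by
    refine (Submodule.mem_iInf _).2 fun n => ?_
    simpa using hf n
  obtain ⟨r, hr⟩ := (Ideal.mem_iInf_smul_pow_eq_bot_iff m f).1 h1
  exact ⟨r, r.2, hr⟩

/-- An ideal that is contained in all powers of each maximal ideal that contains it is zero or the
whole ring, if the spectrum is connected. -/
theorem ideal_eq_bot_or_top [IsAlgClosed k] [Algebra.FiniteType k B]
    [ConnectedSpace (PrimeSpectrum B)] (I : Ideal B)
    (hI : ∀ x : B →ₐ[k] k, I ≤ RingHom.ker x → ∀ n : ℕ, I ≤ RingHom.ker x ^ n) :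
    I = ⊥ ∨ I = ⊤ := by
  have hN : IsNoetherianRing B := Algebra.FiniteType.isNoetherianRing k B
  -- If `f ∈ I` is not in `I²`, the colon ideal `(I² : f)` lies in some maximal `m`. When `I ≤ m`,
  -- Krull's theorem puts `1 - r` with `r ∈ m` in the colon ideal; otherwise any element of `I`
  -- outside `m` is in it. Both are contradictions.
  have hidem : IsIdempotentElem I := by
    refine le_antisymm Ideal.mul_le_right fun f hf => ?_
    by_contra hf2
    let J : Ideal B := (I * I).colon {f}
    have hJ : J ≠ ⊤ := fun h => hf2 (by
      have h1 : (1 : B) ∈ J := h ▸ Submodule.mem_top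
      simpa [J, Submodule.mem_colon_singleton] using h1)
    obtain ⟨m, hm, hJm⟩ := Ideal.exists_le_maximal J hJ
    obtain ⟨x, rfl⟩ := exists_point_ker_eq (k := k) m
    by_cases hIm : I ≤ RingHom.ker x
    · obtain ⟨r, hr, hrf⟩ := exists_mul_eq_self_of_mem_iInf_pow _ fun n => hI x hIm n hf
      have h1 : 1 - r ∈ J := by
        simp [J, Submodule.mem_colon_singleton, sub_mul, hrf]
      have h2 := add_mem (hJm h1) hr
      rw [sub_add_cancel] at h2
      exact hm.ne_top ((Ideal.eq_top_iff_one _).2 h2)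
    · obtain ⟨g, hg, hgm⟩ := SetLike.not_le_iff_exists.1 hIm
      refine hgm (hJm ?_)
      simpa [J, Submodule.mem_colon_singleton] using Ideal.mul_mem_mul hg hf
  -- A finitely generated idempotent ideal is generated by an idempotent, and a connected spectrum
  -- leaves only `0` and `1`.
  obtain ⟨e, he, rfl⟩ := (Ideal.isIdempotentElem_iff_of_fg I (IsNoetherian.noetherian I)).1 hidem
  have h0 : ∀ s : TopologicalSpace.Clopens (PrimeSpectrum B), s = ⊥ ∨ s = ⊤ := fun s =>
    (isClopen_iff.1 s.isClopen).imp (fun h => SetLike.coe_injective h)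
      (fun h => SetLike.coe_injective h)
  rcases h0 (PrimeSpectrum.isIdempotentElemEquivClopens ⟨e, he⟩) with h | h
  · left
    have h1 := congrArg Subtype.val ((OrderIso.symm_apply_eq _).2 h.symm)
    rw [PrimeSpectrum.isIdempotentElemEquivClopens_symm_bot] at h1
    simp only at h1
    rw [← h1]; simp
  · right
    have h1 := congrArg Subtype.val ((OrderIso.symm_apply_eq _).2 h.symm)
    rw [PrimeSpectrum.isIdempotentElemEquivClopens_symm_top] at h1
    simp only at h1
    rw [← h1]; simp

end PointsOfAlgebras

end AlgSetting

/-! ### Left invariant derivations and the adjoint action on coordinate rings. -/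

namespace AlgSetting

section Convolution

variable {k : Type*} [Field k] {A B C : Type*} [CommRing A] [HopfAlgebra k A]
  [CommRing B] [HopfAlgebra k B] [CommRing C] [Algebra k C]

/-- Extension of scalars from the ground field to `C` in the convolution algebra. -/
def extend (C : Type*) [CommRing C] [Algebra k C] (u : WithConv (A →ₗ[k] k)) :
    WithConv (A →ₗ[k] C) :=
  toConv (Algebra.linearMap k C ∘ₗ u.ofConv)

theorem extend_mul (u v : WithConv (A →ₗ[k] k)) :
    extend C (u * v) = extend C u * extend C v :=
  congrArg toConv (LinearMap.algHom_comp_convMul_distrib (Algebra.ofId k C) u v)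

theorem extend_sub (u v : WithConv (A →ₗ[k] k)) :
    extend C (u - v) = extend C u - extend C v :=
  congrArg toConv (LinearMap.comp_sub _ _ _)

/-- A derivation of the values is a derivation of the convolution algebra. -/
theorem derivation_comp_conv_mul (D : Derivation k C C) (u v : WithConv (A →ₗ[k] C)) :
    toConv ((D : C →ₗ[k] C) ∘ₗ (u * v).ofConv) =
      toConv ((D : C →ₗ[k] C) ∘ₗ u.ofConv) * v + u * toConv ((D : C →ₗ[k] C) ∘ₗ v.ofConv) := by
  refine WithConv.ofConv_injective (LinearMap.ext fun a => ?_)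
  change D ((u * v) a) = (toConv ((D : C →ₗ[k] C) ∘ₗ u.ofConv) * v) a +
    (u * toConv ((D : C →ₗ[k] C) ∘ₗ v.ofConv)) a
  rw [(ℛ k a).convMul_apply, (ℛ k a).convMul_apply, (ℛ k a).convMul_apply, map_sum,
    ← Finset.sum_add_distrib]
  refine Finset.sum_congr rfl fun i _ => ?_
  change D (u _ * v _) = D (u _) * v _ + u _ * D (v _)
  rw [Derivation.leibniz, smul_eq_mul, smul_eq_mul]
  ring

theorem derivation_comp_extend (D : Derivation k C C) (u : WithConv (A →ₗ[k] k)) :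
    toConv ((D : C →ₗ[k] C) ∘ₗ (extend C u).ofConv) = 0 := by
  refine WithConv.ofConv_injective (LinearMap.ext fun a => ?_)
  exact D.map_algebraMap _

/-- The map is `f ↦ ∑ f₁ w(f₂)`; the Leibniz rule follows from that of `w` at the unit and the
counit axiom `∑ c₁ ε(c₂) = c`. -/
theorem leftDer_apply_mul {w : WithConv (B →ₗ[k] k)}
    (hw : ∀ a b : B, w (a * b) =
      Coalgebra.counit (R := k) a * w b + w a * Coalgebra.counit (R := k) b) (a b : B) :
    (toConv (LinearMap.id : B →ₗ[k] B) * extend B w) (a * b) =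
      a * (toConv (LinearMap.id : B →ₗ[k] B) * extend B w) b +
        b * (toConv (LinearMap.id : B →ₗ[k] B) * extend B w) a := by
  have h1 : ∀ c : B, ∑ i ∈ (ℛ k c).index,
      (ℛ k c).left i * algebraMap k B (Coalgebra.counit (R := k) ((ℛ k c).right i)) = c :=
    fun c => by
      have h2 := (ℛ k c).convMul_apply (toConv (LinearMap.id : B →ₗ[k] B)) 1
      rw [mul_one] at h2
      exact h2.symm
  have h3 : ∀ c : B, (toConv (LinearMap.id : B →ₗ[k] B) * extend B w) c = ∑ i ∈ (ℛ k c).index,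
      (ℛ k c).left i * algebraMap k B (w ((ℛ k c).right i)) :=
    fun c => (ℛ k c).convMul_apply _ _
  have h4 : (toConv (LinearMap.id : B →ₗ[k] B) * extend B w) (a * b) =
      ∑ i ∈ (ℛ k a).index, ∑ j ∈ (ℛ k b).index, ((ℛ k a).left i * (ℛ k b).left j) *
        algebraMap k B (w ((ℛ k a).right i * (ℛ k b).right j)) := by
    rw [((ℛ k a).mul (ℛ k b)).convMul_apply]
    simp only [Coalgebra.Repr.mul_index, Finset.sum_product]
    rfl
  rw [h4, h3 a, h3 b]
  conv_rhs => enter [1]; rw [← h1 a]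
  conv_rhs => enter [2]; rw [← h1 b]
  rw [Finset.sum_mul_sum, mul_comm (∑ i ∈ (ℛ k b).index, _), Finset.sum_mul_sum]
  simp only [← Finset.sum_add_distrib, hw, map_add, map_mul]
  refine Finset.sum_congr rfl fun i _ => Finset.sum_congr rfl fun j _ => ?_
  ring

/-- The left invariant derivation of the coordinate ring with value `w` at the unit. -/
def leftDer (w : lieAlgebra k B) : Derivation k B B :=
  Derivation.mk' (toConv (LinearMap.id : B →ₗ[k] B) * extend B (w : WithConv (B →ₗ[k] k))).ofConv
    (leftDer_apply_mul w.2)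

theorem point_leftDer (x : WithConv (B →ₐ[k] k)) (w : lieAlgebra k B) (f : B) :
    x (leftDer w f) = (pt x * (w : WithConv (B →ₗ[k] k))) f := by
  have h := LinearMap.algHom_comp_convMul_distrib x.ofConv (toConv (LinearMap.id : B →ₗ[k] B))
    (extend B (w : WithConv (B →ₗ[k] k)))
  have h1 : toConv (x.ofConv.toLinearMap ∘ₗ (extend B (w : WithConv (B →ₗ[k] k))).ofConv) =
      (w : WithConv (B →ₗ[k] k)) :=
    WithConv.ofConv_injective (LinearMap.ext fun a => x.ofConv.commutes _)
  rw [h1] at h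
  exact congrArg (fun T : B →ₗ[k] k => T f) h

/-- The point of the group with values in `B` that is given by a homomorphism `A → B`. -/
def genericPt (p : A →ₐc[k] B) : WithConv (A →ₐ[k] B) := toConv (p : A →ₐ[k] B)

/-- A point with values in `B` as an element of the convolution algebra. -/
def ptLin (g : WithConv (A →ₐ[k] B)) : WithConv (A →ₗ[k] B) := toConv g.ofConv.toLinearMap

theorem ptLin_mul_inv (g : WithConv (A →ₐ[k] B)) : ptLin g * ptLin g⁻¹ = 1 := by
  have h : ptLin (g * g⁻¹) = ptLin g * ptLin g⁻¹ := rfl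
  rw [← h, mul_inv_cancel]
  rfl

theorem ptLin_inv_mul (g : WithConv (A →ₐ[k] B)) : ptLin g⁻¹ * ptLin g = 1 := by
  have h : ptLin (g⁻¹ * g) = ptLin g⁻¹ * ptLin g := rfl
  rw [← h, inv_mul_cancel]
  rfl

theorem leftDer_comp_genericPt (p : A →ₐc[k] B) (w : lieAlgebra k B) :
    toConv ((leftDer w : B →ₗ[k] B) ∘ₗ (ptLin (genericPt p)).ofConv) =
      ptLin (genericPt p) * extend B (differential p w : WithConv (A →ₗ[k] k)) :=
  congrArg toConv (LinearMap.convMul_comp_coalgHom_distrib (toConv (LinearMap.id : B →ₗ[k] B))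
    (extend B (w : WithConv (B →ₗ[k] k))) (p : A →ₗc[k] B))

/-- The function `x ↦ Ad_{p x} z` with values in the convolution algebra, that is, the coordinates
of `Ad_{p x} z` as elements of the coordinate ring `B`. -/
def adCoeff (p : A →ₐc[k] B) (z : WithConv (A →ₗ[k] k)) : WithConv (A →ₗ[k] B) :=
  ptLin (genericPt p) * extend B z * ptLin (genericPt p)⁻¹

/-- Obtained by differentiating `g g⁻¹ = 1`, where `g` is the generic point, whose derivative is `g`
times the differential of `w`. -/
theorem leftDer_comp_genericPt_inv (p : A →ₐc[k] B) (w : lieAlgebra k B) :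
    toConv ((leftDer w : B →ₗ[k] B) ∘ₗ (ptLin (genericPt p)⁻¹).ofConv) =
      -(extend B (differential p w : WithConv (A →ₗ[k] k)) * ptLin (genericPt p)⁻¹) := by
  have h1 := derivation_comp_conv_mul (leftDer w) (ptLin (genericPt p)) (ptLin (genericPt p)⁻¹)
  have h2 : toConv ((leftDer w : B →ₗ[k] B) ∘ₗ (1 : WithConv (A →ₗ[k] B)).ofConv) = 0 :=
    derivation_comp_extend (A := A) (leftDer w) 1
  rw [ptLin_mul_inv, h2, leftDer_comp_genericPt] at h1
  have h3 := congrArg (fun T => ptLin (genericPt p)⁻¹ * T) h1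
  simp only [mul_zero, mul_add, ← mul_assoc, ptLin_inv_mul, one_mul] at h3
  exact (neg_eq_of_add_eq_zero_right h3.symm).symm

/-- Algebraic form of "the differential of `Ad` is `ad`": differentiating `g z g⁻¹` along `w` gives
`g (w z - z w) g⁻¹`. -/
theorem leftDer_adCoeff (p : A →ₐc[k] B) (w : lieAlgebra k B) (z : WithConv (A →ₗ[k] k)) (a : A) :
    leftDer w (adCoeff p z a) =
      adCoeff p ⁅(differential p w : WithConv (A →ₗ[k] k)), z⁆ a := by
  have h : toConv ((leftDer w : B →ₗ[k] B) ∘ₗ (adCoeff p z).ofConv) =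
      adCoeff p ⁅(differential p w : WithConv (A →ₗ[k] k)), z⁆ := by
    have h0 : ⁅(differential p w : WithConv (A →ₗ[k] k)), z⁆ =
      (differential p w : WithConv (A →ₗ[k] k)) * z - z * (differential p w : _) := rfl
    unfold adCoeff
    rw [derivation_comp_conv_mul, derivation_comp_conv_mul, leftDer_comp_genericPt,
      derivation_comp_extend, leftDer_comp_genericPt_inv, h0, extend_sub, extend_mul, extend_mul]
    noncomm_ring
  exact congrArg (fun T : WithConv (A →ₗ[k] B) => T a) h

theorem point_adCoeff (p : A →ₐc[k] B) (x : WithConv (B →ₐ[k] k)) (z : lieAlgebra k A) (a : A) :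
    x (adCoeff p z a) = (Ad (onPoints p x) z : WithConv (A →ₗ[k] k)) a := by
  have h := LinearMap.algHom_comp_convMul_distrib x.ofConv
    (ptLin (genericPt p) * extend B (z : WithConv (A →ₗ[k] k))) (ptLin (genericPt p)⁻¹)
  rw [LinearMap.algHom_comp_convMul_distrib x.ofConv (ptLin (genericPt p))
    (extend B (z : WithConv (A →ₗ[k] k)))] at h
  have h1 : toConv (x.ofConv.toLinearMap ∘ₗ (extend B (z : WithConv (A →ₗ[k] k))).ofConv) =
      (z : WithConv (A →ₗ[k] k)) :=
    WithConv.ofConv_injective (LinearMap.ext fun a => x.ofConv.commutes _)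
  rw [h1] at h
  exact congrArg (fun T : A →ₗ[k] k => T a) h

theorem Ad_one (z : lieAlgebra k A) : Ad (1 : WithConv (A →ₐ[k] k)) z = z := by
  refine Subtype.ext ?_
  change pt 1 * (z : WithConv (A →ₗ[k] k)) * pt (1 : WithConv (A →ₐ[k] k))⁻¹ =
    (z : WithConv (A →ₗ[k] k))
  rw [inv_one, pt_one, one_mul, mul_one]

theorem onPoints_one (p : A →ₐc[k] B) : onPoints p (1 : WithConv (B →ₐ[k] k)) = 1 := by
  refine WithConv.ofConv_injective (AlgHom.ext fun a => ?_)
  exact CoalgHomClass.counit_comp_apply p a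

theorem leftDiff_comp (p : A →ₐc[k] B) (f : A) (x : WithConv (B →ₐ[k] k)) (w : lieAlgebra k B) :
    leftDiff (p f) x w = leftDiff f (onPoints p x) (differential p w) :=
  congrArg (fun T : A →ₗ[k] k => T f) (LinearMap.convMul_comp_coalgHom_distrib (pt x)
    (w : WithConv (B →ₗ[k] k)) (p : A →ₗc[k] B))

theorem rightDiff_comp (p : A →ₐc[k] B) (f : A) (x : WithConv (B →ₐ[k] k)) (w : lieAlgebra k B) :
    rightDiff (p f) x w = rightDiff f (onPoints p x) (differential p w) :=
  congrArg (fun T : A →ₗ[k] k => T f) (LinearMap.convMul_comp_coalgHom_distrib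
    (w : WithConv (B →ₗ[k] k)) (pt x) (p : A →ₗc[k] B))

/-- Derivations at a point are translates of derivations at the unit. -/
theorem inv_mul_derivation_mem_lieAlgebra (x : WithConv (B →ₐ[k] k)) {l : WithConv (B →ₗ[k] k)}
    (hl : ∀ f g, l (f * g) = x f * l g + l f * x g) : pt x⁻¹ * l ∈ lieAlgebra k B := by
  intro a b
  have hx : pt x⁻¹ * pt x = 1 := by rw [← pt_mul, inv_mul_cancel, pt_one]
  have hm : ∀ (y : WithConv (B →ₐ[k] k)) (c d : B), pt y (c * d) = pt y c * pt y d :=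
    fun y c d => map_mul y.ofConv c d
  have hl' : ∀ f g, l (f * g) = pt x f * l g + l f * pt x g := hl
  have e1 := conv_mul_conv (pt x⁻¹) (pt x) (pt x⁻¹) l a b
  have e2 := conv_mul_conv (pt x⁻¹) l (pt x⁻¹) (pt x) a b
  simp only [hx, one_conv_apply] at e1 e2
  rw [conv_apply_mul, e1, e2]
  simp only [← Finset.sum_add_distrib, hl', hm]
  refine Finset.sum_congr rfl fun i _ => Finset.sum_congr rfl fun j _ => ?_
  ring

/-- On a connected group in characteristic zero, an ideal of functions that vanish at the unit and
that is stable under left invariant derivations is zero. -/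
theorem ideal_eq_bot_of_leftDer_stable [IsAlgClosed k] [CharZero k] [Algebra.FiniteType k B]
    [ConnectedSpace (PrimeSpectrum B)] {I : Ideal B} (hI : ∀ w : lieAlgebra k B, ∀ f ∈ I, leftDer w f ∈ I)
    (h1 : ∀ f ∈ I, Coalgebra.counit (R := k) f = 0) : I = ⊥ := by
  have hN : IsNoetherianRing B := Algebra.FiniteType.isNoetherianRing k B
  refine (ideal_eq_bot_or_top (k := k) I fun x hIx n => ?_).resolve_right fun h => ?_
  · obtain ⟨r, l, b, hl, hb, hlb⟩ := exists_point_derivations x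
    -- The point derivations `l i` translated to the unit, so that the left invariant derivation of
    -- `w i` has value `l i` at `x`.
    let w : Fin r → lieAlgebra k B := fun i =>
      ⟨pt (toConv x)⁻¹ * toConv (l i), inv_mul_derivation_mem_lieAlgebra (toConv x) (hl i)⟩
    have hw : ∀ i f, x (leftDer (w i) f) = l i f := fun i f => by
      have h2 := point_leftDer (toConv x) (w i) f
      have h3 : pt (toConv x) * (w i : WithConv (B →ₗ[k] k)) = toConv (l i) := by
        change pt (toConv x) * (pt (toConv x)⁻¹ * toConv (l i)) = _
        rw [← mul_assoc, ← pt_mul, mul_inv_cancel, pt_one, one_mul]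
      rw [h3] at h2
      exact h2
    refine le_pow_of_derivation_stable (k := k) hb (D := fun i => leftDer (w i)) (fun f hf => ?_)
      hIx (fun i f hf => hI _ f hf) n
    have h4 := hlb f
    rw [(RingHom.mem_ker.1 hf : x f = 0), map_zero, sub_zero] at h4
    -- Since `b i ∈ m_x`, replacing `leftDer (w i) f` by its value at `x` changes the sum only by an
    -- element of `m_x²`.
    have h5 : ∑ i, b i * leftDer (w i) f - f =
        ∑ i, b i * (leftDer (w i) f - algebraMap k B (x (leftDer (w i) f))) +
          (∑ i, l i f • b i - f) := by
      have e : ∀ i, b i * leftDer (w i) f =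
          b i * (leftDer (w i) f - algebraMap k B (x (leftDer (w i) f))) + l i f • b i := fun i => by
        rw [hw, Algebra.smul_def]; ring
      rw [Finset.sum_congr rfl fun i _ => e i, Finset.sum_add_distrib, add_sub_assoc]
    rw [h5]
    refine add_mem (sum_mem fun i _ => ?_) h4
    rw [pow_two]
    exact Ideal.mul_mem_mul (hb i) (sub_algebraMap_mem_ker x _)
  · have h2 := h1 1 (h ▸ Submodule.mem_top)
    rw [Bialgebra.counit_one] at h2
    exact one_ne_zero h2

/-- The Lie algebra of an affine algebraic group is finite dimensional. -/
instance finiteDimensional_lieAlgebra [Algebra.FiniteType k A] :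
    FiniteDimensional k (lieAlgebra k A) := by
  obtain ⟨s, hs⟩ := (Algebra.FiniteType.out : (⊤ : Subalgebra k A).FG)
  -- A derivation at the unit is determined by its values on the finitely many generators `s`.
  let e : lieAlgebra k A →ₗ[k] (s → k) :=
    { toFun := fun D a => (D : WithConv (A →ₗ[k] k)) (a : A)
      map_add' := fun _ _ => rfl
      map_smul' := fun _ _ => rfl }
  refine FiniteDimensional.of_injective e (LinearMap.ker_eq_bot.1 (LinearMap.ker_eq_bot'.2 ?_))
  intro D hD
  refine Subtype.ext (WithConv.ofConv_injective (LinearMap.ext fun a => ?_))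
  have ha : a ∈ Algebra.adjoin k (s : Set A) := hs ▸ Algebra.mem_top
  have h1 : (D : WithConv (A →ₗ[k] k)) 1 = 0 := by
    have h := D.2 1 1
    simp only [mul_one, Bialgebra.counit_one, one_mul] at h
    simpa using h
  change (D : WithConv (A →ₗ[k] k)) a = 0
  induction ha using Algebra.adjoin_induction with
  | mem a ha => exact congrFun hD ⟨a, ha⟩
  | algebraMap r =>
    rw [Algebra.algebraMap_eq_smul_one]
    exact ((D : WithConv (A →ₗ[k] k)).ofConv.map_smul r 1).trans (by
      rw [show (D : WithConv (A →ₗ[k] k)).ofConv 1 = 0 from h1, smul_zero])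
  | add a b _ _ iha ihb =>
    exact ((D : WithConv (A →ₗ[k] k)).ofConv.map_add a b).trans
      ((congrArg₂ (· + ·) iha ihb).trans (add_zero 0))
  | mul a b _ _ iha ihb => rw [D.2 a b, iha, ihb, mul_zero, zero_mul, add_zero]

/-- The Lie algebra is finite dimensional and embeds in the dual of `A`, so `A` maps onto its dual.
Matrix coefficients of `Ad` thereby become regular functions. -/
theorem exists_eq_evaluation [Algebra.FiniteType k A] (l : lieAlgebra k A →ₗ[k] k) :
    ∃ a : A, ∀ z : lieAlgebra k A, l z = (z : WithConv (A →ₗ[k] k)) a := by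
  let ev : lieAlgebra k A →ₗ[k] A →ₗ[k] k :=
    { toFun := fun D => (D : WithConv (A →ₗ[k] k)).ofConv
      map_add' := fun _ _ => rfl
      map_smul' := fun _ _ => rfl }
  have hev : Function.Injective ev := fun D E h => Subtype.ext (WithConv.ofConv_injective h)
  obtain ⟨a, ha⟩ := LinearMap.flip_surjective_iff₁.2 hev l
  exact ⟨a, fun z => (congrArg (fun T => T z) ha).symm⟩

end Convolution

/-! ### The lemma for affine algebraic groups. -/

section Morphism

variable {k : Type*} [Field k] [IsAlgClosed k] [CharZero k]
  {A₁ A₂ B₁ B₂ : Type*}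
  [CommRing A₁] [HopfAlgebra k A₁] [Algebra.FiniteType k A₁]
  [CommRing A₂] [HopfAlgebra k A₂] [Algebra.FiniteType k A₂]
  [CommRing B₁] [HopfAlgebra k B₁] [CommRing B₂] [HopfAlgebra k B₂] [Algebra.FiniteType k B₂]
  [ConnectedSpace (PrimeSpectrum B₂)]
  {T₁ : ManinTriple k (lieAlgebra k A₁)} {T₂ : ManinTriple k (lieAlgebra k A₂)}
  {S₁ : Subgroup T₁ B₁} {S₂ : Subgroup T₂ B₂}
  {φ : lieAlgebra k A₁ →ₗ⁅k⁆ lieAlgebra k A₂} {ψ : T₂.h →ₗ⁅k⁆ T₁.h} {p : B₁ →ₐc[k] B₂}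

/-- The forms of `φ v` and `Ad_x (φ v)` correspond to those of `v` and `Ad_{p x} v`. -/
theorem form_Ad_map (hφ : T₁.IsMorphism T₂ φ) (hψ : T₁.IsTranspose T₂ φ ψ)
    (hp : ∀ D : lieAlgebra k B₂, S₁.lieEquiv (differential p D) = ψ (S₂.lieEquiv D))
    (x : WithConv (B₂ →ₐ[k] k)) (u v : lieAlgebra k A₁) :
    T₂.form (φ u) (Ad (onPoints S₂.res x) (φ v)) =
      T₁.form u (Ad (onPoints S₁.res (onPoints p x)) v) := by
  obtain ⟨a₁, ha₁⟩ := exists_eq_evaluation (T₁.form u)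
  obtain ⟨a₂, ha₂⟩ := exists_eq_evaluation (T₂.form (φ u))
  let q : A₁ →ₐc[k] B₂ := p.comp S₁.res
  -- The regular function `y ↦ κ₂(φ u, Ad_y z₁) - κ₁(u, Ad_{p y} z₂)` on `H₂`.
  let c : lieAlgebra k A₂ × lieAlgebra k A₁ → B₂ := fun z =>
    adCoeff S₂.res (z.1 : WithConv (A₂ →ₗ[k] k)) a₂ - adCoeff q (z.2 : WithConv (A₁ →ₗ[k] k)) a₁
  have hc : ∀ (y : WithConv (B₂ →ₐ[k] k)) z, y (c z) =
      T₂.form (φ u) (Ad (onPoints S₂.res y) z.1) - T₁.form u (Ad (onPoints q y) z.2) :=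
    fun y z => by
      rw [ha₁, ha₂, ← point_adCoeff, ← point_adCoeff]
      exact map_sub y.ofConv _ _
  have hder : ∀ w z, leftDer w (c z) =
      c (⁅(S₂.lieEquiv w : lieAlgebra k A₂), z.1⁆, ⁅(ψ (S₂.lieEquiv w) : lieAlgebra k A₁), z.2⁆) :=
    fun w z => by
      have hq : differential q w = (ψ (S₂.lieEquiv w) : lieAlgebra k A₁) := by
        rw [← hp, S₁.lieEquiv_apply]
        rfl
      simp only [c, map_sub, leftDer_adCoeff, hq, S₂.lieEquiv_apply]
      rfl
  -- By `hder` and stability of the graph, derivations carry the generators to generators; at the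
  -- unit these take the value of the pairing, which is zero on the graph.
  have hI : Ideal.span (c '' (ManinTriple.graph T₂ φ ψ : Set _)) = ⊥ := by
    refine ideal_eq_bot_of_leftDer_stable (k := k) (fun w f hf => ?_) fun f hf => ?_
    · induction hf using Submodule.span_induction with
      | mem f hf =>
        obtain ⟨z, hz, rfl⟩ := hf
        rw [hder]
        exact Ideal.subset_span ⟨_, hψ.lie_mem_graph hφ (S₂.lieEquiv w) hz, rfl⟩
      | zero => simp
      | add f g _ _ ihf ihg => rw [map_add]; exact add_mem ihf ihg
      | smul b f hf ih =>
        rw [smul_eq_mul, Derivation.leibniz]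
        exact add_mem (Ideal.mul_mem_left _ _ ih) (Ideal.mul_mem_right _ _ hf)
    · have hle : Ideal.span (c '' (ManinTriple.graph T₂ φ ψ : Set _)) ≤
          RingHom.ker (Bialgebra.counitAlgHom k B₂) := by
        refine Ideal.span_le.2 ?_
        rintro _ ⟨z, hz, rfl⟩
        have h1 := hc 1 z
        rw [onPoints_one, onPoints_one, Ad_one, Ad_one] at h1
        exact h1.trans (hψ.pairing_eq_zero hφ u hz)
      exact hle hf
  have h0 : c (φ v, v) = 0 := by
    have h1 : c (φ v, v) ∈ Ideal.span (c '' (ManinTriple.graph T₂ φ ψ : Set _)) :=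
      Ideal.subset_span ⟨_, ManinTriple.map_mem_graph v, rfl⟩
    rwa [hI, Ideal.mem_bot] at h1
  have h2 := hc x (φ v, v)
  rw [h0] at h2
  exact sub_eq_zero.1 (h2.symm.trans (map_zero x.ofConv))

theorem bracketValue_comp (hφ : T₁.IsMorphism T₂ φ) (hψ : T₁.IsTranspose T₂ φ ψ)
    (hp : ∀ D : lieAlgebra k B₂, S₁.lieEquiv (differential p D) = ψ (S₂.lieEquiv D))
    (f g : B₁) (x : WithConv (B₂ →ₐ[k] k)) :
    S₂.poissonBracket (p f) (p g) x = S₁.poissonBracket f g (onPoints p x) ∧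
      S₂.leftBracket (p f) (p g) x = S₁.leftBracket f g (onPoints p x) := by
  have hsymm : ∀ w : T₂.h, differential p (S₂.lieEquiv.symm w) = S₁.lieEquiv.symm (ψ w) :=
    fun w => S₁.lieEquiv.injective (by
      rw [LinearEquiv.apply_symm_apply, hp, LinearEquiv.apply_symm_apply])
  have hL : ∀ f : B₁, leftDiff (p f) x ∘ₗ S₂.lieEquiv.symm.toLinearMap =
      (leftDiff f (onPoints p x) ∘ₗ S₁.lieEquiv.symm.toLinearMap) ∘ₗ (ψ : T₂.h →ₗ[k] T₁.h) :=
    fun f => LinearMap.ext fun w => (leftDiff_comp p f x _).trans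
      (congrArg (leftDiff f (onPoints p x)) (hsymm w))
  have hR : ∀ f : B₁, rightDiff (p f) x ∘ₗ S₂.lieEquiv.symm.toLinearMap =
      (rightDiff f (onPoints p x) ∘ₗ S₁.lieEquiv.symm.toLinearMap) ∘ₗ (ψ : T₂.h →ₗ[k] T₁.h) :=
    fun f => LinearMap.ext fun w => (rightDiff_comp p f x _).trans
      (congrArg (rightDiff f (onPoints p x)) (hsymm w))
  unfold Subgroup.poissonBracket Subgroup.leftBracket
  rw [hL f, hL g, hR f, hR g]
  exact ⟨hψ.bracketValue_comp hφ (form_Ad_map hφ hψ hp x) _ _ _ _,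
    hψ.bracketValue_comp hφ (form_Ad_map hφ hψ hp x) _ _ _ _⟩

end Morphism

end AlgSetting

end

/-- The first part treats real and complex Lie groups, the second affine algebraic groups over an
algebraically closed field of characteristic zero. -/
theorem mainTheorem9 :
    (∀ {𝕜 : Type*} [RCLike 𝕜]
      {E₁ E₂ F₁ F₂ : Type*}
      [NormedAddCommGroup E₁] [NormedSpace 𝕜 E₁] [FiniteDimensional 𝕜 E₁] [CompleteSpace E₁]
      [NormedAddCommGroup E₂] [NormedSpace 𝕜 E₂] [FiniteDimensional 𝕜 E₂] [CompleteSpace E₂]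
      [NormedAddCommGroup F₁] [NormedSpace 𝕜 F₁] [FiniteDimensional 𝕜 F₁] [CompleteSpace F₁]
      [NormedAddCommGroup F₂] [NormedSpace 𝕜 F₂] [FiniteDimensional 𝕜 F₂] [CompleteSpace F₂]
      {G₁ G₂ H₁ H₂ : Type*}
      [TopologicalSpace G₁] [ChartedSpace E₁ G₁] [Group G₁] [LieGroup 𝓘(𝕜, E₁) ∞ G₁]
      [TopologicalSpace G₂] [ChartedSpace E₂ G₂] [Group G₂] [LieGroup 𝓘(𝕜, E₂) ∞ G₂]
      [TopologicalSpace H₁] [ChartedSpace F₁ H₁] [Group H₁] [LieGroup 𝓘(𝕜, F₁) ∞ H₁]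
      [TopologicalSpace H₂] [ChartedSpace F₂ H₂] [Group H₂] [LieGroup 𝓘(𝕜, F₂) ∞ H₂]
      [ConnectedSpace H₁] [ConnectedSpace H₂]
      (T₁ : ManinTriple 𝕜 (GroupLieAlgebra 𝓘(𝕜, E₁) G₁))
      (T₂ : ManinTriple 𝕜 (GroupLieAlgebra 𝓘(𝕜, E₂) G₂))
      (S₁ : LieSetting.Subgroup T₁ F₁ H₁) (S₂ : LieSetting.Subgroup T₂ F₂ H₂)
      (φ : GroupLieAlgebra 𝓘(𝕜, E₁) G₁ →ₗ⁅𝕜⁆ GroupLieAlgebra 𝓘(𝕜, E₂) G₂)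
      (_ : T₁.IsMorphism T₂ φ)
      (ψ : T₂.h →ₗ⁅𝕜⁆ T₁.h) (_ : T₁.IsTranspose T₂ φ ψ)
      (Ψ : H₂ →* H₁) (_ : ContMDiff 𝓘(𝕜, F₂) 𝓘(𝕜, F₁) ∞ Ψ)
      (_ : ∀ w : GroupLieAlgebra 𝓘(𝕜, F₂) H₂,
        S₁.lieEquiv (mfderiv 𝓘(𝕜, F₂) 𝓘(𝕜, F₁) Ψ 1 w) = ψ (S₂.lieEquiv w))
      (U : Set H₁) (_ : IsOpen U) (f g : H₁ → 𝕜)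
      (_ : ContMDiffOn 𝓘(𝕜, F₁) 𝓘(𝕜, 𝕜) ∞ f U) (_ : ContMDiffOn 𝓘(𝕜, F₁) 𝓘(𝕜, 𝕜) ∞ g U)
      (x : H₂) (_ : Ψ x ∈ U),
      S₂.poissonBracket (f ∘ Ψ) (g ∘ Ψ) x = S₁.poissonBracket f g (Ψ x) ∧
      S₂.leftBracket (f ∘ Ψ) (g ∘ Ψ) x = S₁.leftBracket f g (Ψ x)) ∧
    (∀ {k : Type*} [Field k] [IsAlgClosed k] [CharZero k]
      {A₁ A₂ B₁ B₂ : Type*}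
      [CommRing A₁] [HopfAlgebra k A₁] [Algebra.FiniteType k A₁]
      [CommRing A₂] [HopfAlgebra k A₂] [Algebra.FiniteType k A₂]
      [CommRing B₁] [HopfAlgebra k B₁] [Algebra.FiniteType k B₁]
      [CommRing B₂] [HopfAlgebra k B₂] [Algebra.FiniteType k B₂]
      [ConnectedSpace (PrimeSpectrum B₁)] [ConnectedSpace (PrimeSpectrum B₂)]
      (T₁ : ManinTriple k (AlgSetting.lieAlgebra k A₁))
      (T₂ : ManinTriple k (AlgSetting.lieAlgebra k A₂))
      (S₁ : AlgSetting.Subgroup T₁ B₁) (S₂ : AlgSetting.Subgroup T₂ B₂)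
      (φ : AlgSetting.lieAlgebra k A₁ →ₗ⁅k⁆ AlgSetting.lieAlgebra k A₂)
      (_ : T₁.IsMorphism T₂ φ)
      (ψ : T₂.h →ₗ⁅k⁆ T₁.h) (_ : T₁.IsTranspose T₂ φ ψ)
      (p : B₁ →ₐc[k] B₂)
      (_ : ∀ D : AlgSetting.lieAlgebra k B₂,
        S₁.lieEquiv (AlgSetting.differential p D) = ψ (S₂.lieEquiv D))
      (f g : B₁) (x : WithConv (B₂ →ₐ[k] k)),
      S₂.poissonBracket (p f) (p g) x = S₁.poissonBracket f g (AlgSetting.onPoints p x) ∧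
      S₂.leftBracket (p f) (p g) x = S₁.leftBracket f g (AlgSetting.onPoints p x)) := by
  refine ⟨?_, ?_⟩
  · intro 𝕜 _ E₁ E₂ F₁ F₂ _ _ _ _ _ _ _ _ _ _ _ _ _ _ _ _ G₁ G₂ H₁ H₂ _ _ _ _ _ _ _ _ _ _ _ _ _ _
      _ _ _ _ T₁ T₂ S₁ S₂ φ hφ ψ hψ Ψ hΨ hΨψ U hU f g hf hg x hx
    exact LieSetting.bracketValue_comp hφ hψ hΨ hΨψ
      ((hf.contMDiffAt (hU.mem_nhds hx)).mdifferentiableAt (by simp))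
      ((hg.contMDiffAt (hU.mem_nhds hx)).mdifferentiableAt (by simp))
  · intro k _ _ _ A₁ A₂ B₁ B₂ _ _ _ _ _ _ _ _ _ _ _ _ _ _ T₁ T₂ S₁ S₂ φ hφ ψ hψ p hp f g x
    exact AlgSetting.bracketValue_comp hφ hψ hp f g x
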